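/- Let $\mathbb F\subset\mathbb Z$ be one of $\{0,1,2,\dots\}$, $\{\dots,-2,-1,0\}$, $\mathbb Z$, $\{0,1,\dots,N\}$ ($N\ge 0$). Let $(t_n)_{n\in\mathbb F}$ be a strictly increasing real sequence with no finite accumulation point, let $w_n>0$, and suppose that $\Gamma=\sum_{n\in\mathbb F} w_n\delta_{t_n}$ is a Herglotz measure, i.e. $\int \frac{1}{1+t^2}\,\Gamma(dt)<\infty$. *The operator.* Let $M^\Gamma$ be multiplication by the independent variable in $L^2(\Gamma)$ on its maximal domain, and let $T=T^\Gamma$ be its restriction to $\{f\in\operatorname{Dom}(M^\Gamma) : \int f\,d\Gamma=0\}$. The canonical deficiency vectors of $T$ are $$\phi_+(t)=b_{-i}(t)=\frac1{t-i}\in\operatorname{Ran}(T+i)^\perp,\qquad \phi_-(t)=b_{i}(t)=\frac1{t+i}\in\operatorname{Ran}(T-i)^\perp ,$$ where $b_w(t):=1/(t-\overline w)$; they are non-zero and $\|\phi_+\|=\|\phi_-\|$. *The extensions.* Let $V$ be the partial isometry with $V(T+i)x=(T-i)x$ for $x\in\operatorname{Dom}(T)$ and $V=0$ on $\operatorname{Ran}(T+i)^\perp$.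 For $\theta\in[0,1)$ put $$U_\theta=V+\frac{e^{2\pi i\theta}}{\|\phi_+\|^2}\langle\phi_+,\cdot\rangle\,\phi_-$$ (inner products are conjugate linear in the first variable), and let $T_\theta$ be the inverse Cayley transform of $U_\theta$, $T_\theta (1-U_\theta)f=i(1+U_\theta)f$. If $1$ is an eigenvalue of $U_\theta$ (this happens for at most one $\theta$), then $T_\theta$ is understood as the linear relation $\{((1-U_\theta)f,\,i(1+U_\theta)f)\}$. The spectrum $\sigma(T_\theta)$ is the complement of the set of $z\in\mathbb C$ for which $(T_\theta-z)^{-1}$ is an everywhere defined bounded operator. *The spectral function.* The spectral function of $T$ fixed by $\phi_\pm$ is the strictly increasing bijection $t:J\to\mathbb R$ from an (automatically open) interval $J$ with $J\cap\mathbb Z=\mathbb F$ such that $t(n)=t_n$ for $n\in\mathbb F$ and $$\sigma(T_\theta)=\{\,t(n+\theta) : n\in\mathbb Z,\ n+\theta\in J\,\}\qquad(0\le\theta<1).$$ For $n\in\mathbb F$ write $t_n(\theta)=t(n+\theta)$; this is the point of $\sigma(T_\theta)$ in $[t_n,t_{n+1})$, where $t_{n+1}=+\infty$ if $n+1\notin\mathbb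 F$ (it is defined for all $\theta\ge0$ with $n+\theta\in J$, $\theta<1$). In particular $\sigma(T_0)=\{t_n\}$. **Proposition.** The spectral function $t$ exists, it is differentiable at every $n\in\mathbb F$, and $$w_n=\frac{\|\phi_+\|^2}{\pi}\,t_n'(0)=\frac{\|\phi_+\|^2}{\pi}\,t'(n)\qquad(n\in\mathbb F),$$ where $t_n'(0)$ is the right derivative of $\theta\mapsto t_n(\theta)$ at $0$. If $\Gamma$ is normalized, i.e. $\|\phi_+\|^2=\int\frac{1}{1+t^2}\,\Gamma(dt)=1$, then $t'(n)=\pi w_n$ for all $n\in\mathbb F$. Moreover $\Gamma$ is normalized if and only if $(t_n)$, $(t_n')$ with $t_n':=\pi w_n$ is a normalized bandlimit pair, i.e. $(t_n)_{n\in\mathbb F}$ is strictly increasing without finite accumulation point, $t_n'>0$ for all $n$, and $\sum_n\frac{t_n'}{1+t_n^2}=\pi$ (a convergent series). -/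

import Mathlib

open MeasureTheory Set Filter Topology

noncomputable section

/-! ### Symmetric linear transformations, Cayley transforms and their extensions -/

section Abstract

variable {H : Type*} [NormedAddCommGroup H] [InnerProductSpace ℂ H]

/-- `ran (T - conj z)ᗮ`, which is `ker (T* - z)` (also when `T` is not densely defined and `T*`
is a linear relation). -/
def deficiencySpace (T : H →ₗ.[ℂ] H) (z : ℂ) : Set H :=
  {g | ∀ y : T.domain, inner ℂ (T y - (starRingEnd ℂ) z • (y : H)) g = 0}

/-- `φp ∈ ker (T* - i)`, `φm ∈ ker (T* + i)` are non-zero vectors of equal norm. -/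
structure IsDeficiencyPair (T : H →ₗ.[ℂ] H) (φp φm : H) : Prop where
  mem_plus : φp ∈ deficiencySpace T Complex.I
  mem_minus : φm ∈ deficiencySpace T (-Complex.I)
  ne_zero : φp ≠ 0
  norm_eq : ‖φp‖ = ‖φm‖

/-- The graph of the partial isometry `V = b(T)`, where `b(z) = (z - i) / (z + i)`: it sends
`(T + i) x` to `(T - i) x` for `x` in the domain of `T`, and vanishes on `ran (T + i)ᗮ`. -/
def cayleyGraph (T : H →ₗ.[ℂ] H) : Set (H × H) :=
  {p | ∃ (x : T.domain) (g : H), g ∈ deficiencySpace T Complex.I ∧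
    p = (T x + Complex.I • (x : H) + g, T x - Complex.I • (x : H))}

/-- The graph of `U(α) = V + (α / ‖φp‖²) ⟨φp, ·⟩ φm`, where `V = b(T)`. -/
def unitaryExtensionGraph (T : H →ₗ.[ℂ] H) (φp φm : H) (α : ℂ) : Set (H × H) :=
  {p | ∃ v : H, (p.1, v) ∈ cayleyGraph T ∧
    p.2 = v + (α / (‖φp‖ : ℂ) ^ 2 * inner ℂ φp p.1) • φm}

/-- The graph of `T_θ = b⁻¹(U(α))`, where `α = exp (2 π i θ)` and `b⁻¹(w) = i (1 + w) / (1 - w)`: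
it consists of the pairs `((1 - U) f, i (1 + U) f)`. When `1` is an eigenvalue of `U(α)`, which
happens for at most one `θ` in `[0, 1)`, this is a self-adjoint linear relation; otherwise it is the
graph of a self-adjoint operator. -/
def extensionGraph (T : H →ₗ.[ℂ] H) (φp φm : H) (θ : ℝ) : Set (H × H) :=
  {p | ∃ f u : H,
    (f, u) ∈ unitaryExtensionGraph T φp φm (Complex.exp (2 * Real.pi * Complex.I * θ)) ∧
    p = (f - u, Complex.I • (f + u))}

/-- The spectrum of a linear transformation (or linear relation) with graph `G`: the complement of
the set of `z` for which `(G - z)⁻¹` is a bounded operator defined on the whole space. -/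
def graphSpectrum (G : Set (H × H)) : Set ℂ :=
  {z | ¬ ∃ R : H →L[ℂ] H, ∀ x y : H, (x, y + z • x) ∈ G ↔ R y = x}

/-- `s` is the spectral function of `T` fixed by the deficiency vectors `φp`, `φm`, where the
spectrum `(t n)` of `T_0` is enumerated increasingly by `F ⊆ ℤ`. Its domain is the interval `J`,
which is open because `s` is a strictly increasing bijection of `J` onto `ℝ`. By monotonicity,
`s (n + θ)` is the only point of the spectrum of `T_θ` in `[t n, t (n + 1))`. -/
structure IsSpectralFunction (T : H →ₗ.[ℂ] H) (φp φm : H) {F : Set ℤ} (t : F → ℝ)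
    (J : Set ℝ) (s : ℝ → ℝ) : Prop where
  deficiency : IsDeficiencyPair T φp φm
  ordConnected : J.OrdConnected
  strictMonoOn : StrictMonoOn s J
  surjOn : Set.SurjOn s J Set.univ
  mem_iff : ∀ n : ℤ, (n : ℝ) ∈ J ↔ n ∈ F
  apply_index : ∀ n : F, s ((n : ℤ) : ℝ) = t n
  spectrum_eq : ∀ θ ∈ Set.Ico (0 : ℝ) 1,
    graphSpectrum (extensionGraph T φp φm θ) =
      {z : ℂ | ∃ n : ℤ, (n : ℝ) + θ ∈ J ∧ z = (s ((n : ℝ) + θ) : ℂ)}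

end Abstract

/-! ### Bandlimit pairs -/

/-- The admissible index sets: `{0, 1, 2, …}`, `{…, -2, -1, 0}`, `ℤ`, or `{0, 1, …, N}`. -/
def IsIndexSet (F : Set ℤ) : Prop :=
  F = Set.Ici 0 ∨ F = Set.Iic 0 ∨ F = Set.univ ∨ ∃ N : ℕ, F = Set.Icc 0 (N : ℤ)

/-- Bandlimit pairs of sequences `(t, t')` indexed by `F`. -/
structure IsBandlimitPair (F : Set ℤ) (t t' : F → ℝ) : Prop where
  index : IsIndexSet F
  strictMono : StrictMono t
  no_accumulation : ∀ p : ℝ, ¬ AccPt p (𝓟 (Set.range t))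
  pos : ∀ n, 0 < t' n
  summable : Summable fun n => t' n / (1 + t n ^ 2)

/-- A bandlimit pair is normalized if `∑ t'ₙ / (1 + tₙ²) = π`. -/
structure IsNormalizedBandlimitPair (F : Set ℤ) (t t' : F → ℝ) : Prop
    extends IsBandlimitPair F t t' where
  tsum_eq : ∑' n, t' n / (1 + t n ^ 2) = Real.pi

/-! ### Herglotz measures and the symmetric linear transformation of a Herglotz measure -/

/-- The Herglotz condition on a positive Borel measure on `ℝ`. -/
def IsHerglotz (Γ : Measure ℝ) : Prop :=
  ∫⁻ t : ℝ, ENNReal.ofReal (1 / (1 + t ^ 2)) ∂Γ < ⊤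

/-- The measure `∑ₙ wₙ δ_{tₙ}`. -/
def atomicMeasure {ι : Type*} (t w : ι → ℝ) : Measure ℝ :=
  Measure.sum fun n => ENNReal.ofReal (w n) • Measure.dirac (t n)

theorem IsHerglotz.memLp_cauchy {Γ : Measure ℝ} (hΓ : IsHerglotz Γ) {w : ℂ} (hw : w.im ≠ 0) :
    MemLp (fun t : ℝ => 1 / ((t : ℂ) - (starRingEnd ℂ) w)) 2 Γ := by
  have hne : ∀ t : ℝ, (t : ℂ) - (starRingEnd ℂ) w ≠ 0 := by
    intro t h
    have := congrArg Complex.im h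
    simp at this
    exact hw this
  have hcont : Continuous (fun t : ℝ => 1 / ((t : ℂ) - (starRingEnd ℂ) w)) := by
    refine continuous_const.div (by fun_prop) hne
  have hH : Integrable (fun t : ℝ => 1 / (1 + t ^ 2)) Γ := by
    refine ⟨?_, ?_⟩
    · have : Continuous (fun t : ℝ => 1 / (1 + t ^ 2)) :=
        continuous_const.div (by fun_prop) (fun t => by positivity)
      exact this.aestronglyMeasurable
    · rw [hasFiniteIntegral_iff_ofReal (Eventually.of_forall fun t => by positivity)]
      exact hΓ
  rw [memLp_two_iff_integrable_sq_norm hcont.aestronglyMeasurable]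
  set C : ℝ := 2 + (1 + 2 * w.re ^ 2) / w.im ^ 2 with hC
  refine (hH.const_mul C).mono' (hcont.norm.pow 2).aestronglyMeasurable (Eventually.of_forall fun t => ?_)
  have hb : 0 < w.im ^ 2 := by positivity
  have hn : ‖(t : ℂ) - (starRingEnd ℂ) w‖ ^ 2 = (t - w.re) ^ 2 + w.im ^ 2 := by
    rw [← Complex.normSq_eq_norm_sq, Complex.normSq_apply]
    simp
    ring
  rw [norm_div, norm_one, div_pow, one_pow, hn, Real.norm_of_nonneg (by positivity),
    mul_one_div, div_le_div_iff₀ (by positivity) (by positivity)]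
  have h1 : C * ((t - w.re) ^ 2 + w.im ^ 2)
      = 2 * (t - w.re) ^ 2 + 2 * w.im ^ 2 + (1 + 2 * w.re ^ 2) / w.im ^ 2 * (t - w.re) ^ 2
        + (1 + 2 * w.re ^ 2) := by
    rw [hC]
    field_simp
    ring
  have h2 : 0 ≤ (1 + 2 * w.re ^ 2) / w.im ^ 2 * (t - w.re) ^ 2 := by positivity
  rw [h1]
  nlinarith [sq_nonneg (t - 2 * w.re)]

/-- The vector `b_w(t) = 1 / (t - conj w)` of `L²(Γ)`, for `w` in `ℂ \ ℝ`. -/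
def cauchyVector {Γ : Measure ℝ} (hΓ : IsHerglotz Γ) (w : ℂ) (hw : w.im ≠ 0) : Lp ℂ 2 Γ :=
  (hΓ.memLp_cauchy hw).toLp _

/-- The canonical deficiency vector `φ₊ = b_{-i}`. -/
def canonicalPlus {Γ : Measure ℝ} (hΓ : IsHerglotz Γ) : Lp ℂ 2 Γ :=
  cauchyVector hΓ (-Complex.I) (by simp)

/-- The canonical deficiency vector `φ₋ = b_i`. -/
def canonicalMinus {Γ : Measure ℝ} (hΓ : IsHerglotz Γ) : Lp ℂ 2 Γ :=
  cauchyVector hΓ Complex.I (by simp)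

theorem ae_mul_add {Γ : Measure ℝ} (f g : Lp ℂ 2 Γ) :
    (fun t : ℝ => (t : ℂ) * (f + g : Lp ℂ 2 Γ) t)
      =ᵐ[Γ] (fun t : ℝ => (t : ℂ) * f t) + fun t : ℝ => (t : ℂ) * g t := by
  filter_upwards [Lp.coeFn_add f g] with t ht
  simp only [ht, Pi.add_apply, mul_add]

theorem ae_mul_smul {Γ : Measure ℝ} (c : ℂ) (f : Lp ℂ 2 Γ) :
    (fun t : ℝ => (t : ℂ) * (c • f : Lp ℂ 2 Γ) t) =ᵐ[Γ] c • fun t : ℝ => (t : ℂ) * f t := by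
  filter_upwards [Lp.coeFn_smul c f] with t ht
  simp only [ht, Pi.smul_apply, smul_eq_mul]
  ring

/-- The domain of multiplication by `t` in `L²(Γ)`. -/
def mulDomain (Γ : Measure ℝ) : Submodule ℂ (Lp ℂ 2 Γ) where
  carrier := {f | MemLp (fun t : ℝ => (t : ℂ) * f t) 2 Γ}
  add_mem' {f g} hf hg := (memLp_congr_ae (ae_mul_add f g)).2 (MemLp.add hf hg)
  zero_mem' := by
    refine (memLp_congr_ae ?_).2 (MemLp.zero (ε := ℂ) (p := 2) (μ := Γ))
    filter_upwards [Lp.coeFn_zero ℂ 2 Γ] with t ht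
    rw [ht]
    simp
  smul_mem' c f hf := (memLp_congr_ae (ae_mul_smul c f)).2 (MemLp.const_smul hf c)

theorem mulDomain.memLp {Γ : Measure ℝ} {f : Lp ℂ 2 Γ} (hf : f ∈ mulDomain Γ) :
    MemLp (fun t : ℝ => (t : ℂ) * f t) 2 Γ := hf

/-- The operator `M^Γ` of multiplication by `t` in `L²(Γ)`. -/
def mulOperator (Γ : Measure ℝ) : Lp ℂ 2 Γ →ₗ.[ℂ] Lp ℂ 2 Γ where
  domain := mulDomain Γ
  toFun :=
    { toFun := fun f => (mulDomain.memLp f.2).toLp (fun t : ℝ => (t : ℂ) * (f : Lp ℂ 2 Γ) t)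
      map_add' := fun f g => by
        refine Lp.ext ?_
        filter_upwards [(mulDomain.memLp (f + g).2).coeFn_toLp, (mulDomain.memLp f.2).coeFn_toLp,
          (mulDomain.memLp g.2).coeFn_toLp, ae_mul_add (f : Lp ℂ 2 Γ) g,
          Lp.coeFn_add ((mulDomain.memLp f.2).toLp _) ((mulDomain.memLp g.2).toLp _)]
          with t h1 h2 h3 h4 h5
        rw [h1, h5, Pi.add_apply, h2, h3]
        exact h4
      map_smul' := fun c f => by
        refine Lp.ext ?_
        filter_upwards [(mulDomain.memLp (c • f).2).coeFn_toLp, (mulDomain.memLp f.2).coeFn_toLp,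
          ae_mul_smul c (f : Lp ℂ 2 Γ), Lp.coeFn_smul c ((mulDomain.memLp f.2).toLp _)]
          with t h1 h2 h3 h4
        rw [h1, RingHom.id_apply, h4, Pi.smul_apply, h2]
        exact h3 }

theorem IsHerglotz.integrable {Γ : Measure ℝ} (hΓ : IsHerglotz Γ) {f : Lp ℂ 2 Γ}
    (hf : f ∈ mulDomain Γ) : Integrable f Γ := by
  have h1 : MemLp (fun t : ℝ => (t : ℂ) * f t + Complex.I * f t) 2 Γ :=
    MemLp.add hf ((Lp.memLp f).const_mul Complex.I)
  have h2 := hΓ.memLp_cauchy (w := Complex.I) (by simp)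
  refine (h1.integrable_mul h2).congr (Eventually.of_forall fun t => ?_)
  have hne : (t : ℂ) + Complex.I ≠ 0 := by
    intro h
    have := congrArg Complex.im h
    simp at this
  simp only [Pi.mul_apply, Complex.conj_I, sub_neg_eq_add]
  field_simp

/-- The domain of `T^Γ`: the `f` in the domain of `M^Γ` with `∫ f dΓ = 0`. -/
def herglotzDomain {Γ : Measure ℝ} (hΓ : IsHerglotz Γ) : Submodule ℂ (Lp ℂ 2 Γ) where
  carrier := {f | f ∈ mulDomain Γ ∧ ∫ t, f t ∂Γ = 0}
  add_mem' {f g} hf hg := by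
    refine ⟨add_mem hf.1 hg.1, ?_⟩
    rw [integral_congr_ae (Lp.coeFn_add f g)]
    simp only [Pi.add_apply]
    rw [integral_add (hΓ.integrable hf.1) (hΓ.integrable hg.1), hf.2, hg.2, add_zero]
  zero_mem' := by
    refine ⟨zero_mem _, ?_⟩
    rw [integral_congr_ae (Lp.coeFn_zero ℂ 2 Γ)]
    simp
  smul_mem' c f hf := by
    refine ⟨Submodule.smul_mem _ c hf.1, ?_⟩
    rw [integral_congr_ae (Lp.coeFn_smul c f)]
    simp only [Pi.smul_apply]
    rw [integral_smul, hf.2, smul_zero]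

/-- The symmetric linear transformation `T^Γ`, the restriction of `M^Γ` to `herglotzDomain`. -/
def herglotzOperator {Γ : Measure ℝ} (hΓ : IsHerglotz Γ) : Lp ℂ 2 Γ →ₗ.[ℂ] Lp ℂ 2 Γ :=
  (mulOperator Γ).domRestrict (herglotzDomain hΓ)

end

/-! ### Multiplication by bounded functions -/

noncomputable section

/-! Write K = ‖φ₊‖². The vector φ₊ spans the orthogonal complement of Ran(T + i), and multiplication
by (t - i)/(t + i) extends V and sends φ₊ to φ₋. Hence U_θ is this multiplication plus (α - 1)/K
⟨φ₊, ·⟩ φ₋ with α = exp(2πiθ), a rank-one perturbation. The point z lies in σ(T_θ) iff (i - z) + (i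
+ z)U_θ fails to be bijective. On an atomic measure this operator can be solved coordinate by
coordinate, up to the single scalar ⟨φ₊, f⟩.

Away from the atoms the outcome is the equation m(z) sin πθ = -K cos πθ, where m(z) = ∫ (1/(x - z) -
x/(1 + x²)) dΓ(x) (`mem_graphSpectrum_iff_of_ne`). An atom is a spectral point iff θ = 0
(`atom_mem_graphSpectrum_iff`). Since Im m ≠ 0 off the real line, the spectrum is real.

On each gap m is continuous and strictly increasing, and at t_n it has a simple pole w_n/(t_n - y).
So -cot πθ = m/K is inverted by the phase n + 1/2 + arctan(m/K)/π, with n the index of the gap.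
Together with the value n at t_n this is a continuous, strictly increasing function on ℝ whose
inverse is a spectral function (`isSpectralFunction_invFun`). Near t_n the pole dominates, and the
phase has derivative K/(π w_n) there (`hasDerivAt_phase`).

For an arbitrary spectral function s, the spectra determine the phase of s(q) only modulo 1.
Continuity at n and s(n) = t_n remove the integer, so s is a local inverse of the phase and s'(n) =
π w_n/K. The normalization statement is K = ∑ w_n/(1 + t_n²), multiplied by π. -/

theorem memLp_bounded_mul {Γ : Measure ℝ} {φ : ℝ → ℂ} (hφ : AEStronglyMeasurable φ Γ) {C : ℝ}
    (hC : ∀ᵐ t ∂Γ, ‖φ t‖ ≤ C) (f : Lp ℂ 2 Γ) : MemLp (fun t => φ t * f t) 2 Γ := by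
  refine MemLp.of_le_mul (c := C) (Lp.memLp f) (hφ.mul (Lp.aestronglyMeasurable f)) ?_
  filter_upwards [hC] with t ht
  rw [norm_mul]
  gcongr

/-- Multiplication by a bounded function on `L²(Γ)`. -/
def boundedMul {Γ : Measure ℝ} (φ : ℝ → ℂ) (hφ : AEStronglyMeasurable φ Γ) (C : ℝ)
    (hC : ∀ᵐ t ∂Γ, ‖φ t‖ ≤ C) : Lp ℂ 2 Γ →L[ℂ] Lp ℂ 2 Γ :=
  LinearMap.mkContinuous
    { toFun := fun f => (memLp_bounded_mul hφ hC f).toLp _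
      map_add' := fun f g => by
        refine Lp.ext ?_
        filter_upwards [(memLp_bounded_mul hφ hC (f + g)).coeFn_toLp,
          (memLp_bounded_mul hφ hC f).coeFn_toLp, (memLp_bounded_mul hφ hC g).coeFn_toLp,
          Lp.coeFn_add f g, Lp.coeFn_add ((memLp_bounded_mul hφ hC f).toLp _)
            ((memLp_bounded_mul hφ hC g).toLp _)] with t h1 h2 h3 h4 h5
        rw [h1, h5, Pi.add_apply, h2, h3, h4, Pi.add_apply, mul_add]
      map_smul' := fun c f => by
        refine Lp.ext ?_
        filter_upwards [(memLp_bounded_mul hφ hC (c • f)).coeFn_toLp,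
          (memLp_bounded_mul hφ hC f).coeFn_toLp, Lp.coeFn_smul c f,
          Lp.coeFn_smul c ((memLp_bounded_mul hφ hC f).toLp _)] with t h1 h2 h3 h4
        rw [h1, RingHom.id_apply, h4, Pi.smul_apply, h2, h3, Pi.smul_apply, smul_eq_mul,
          smul_eq_mul]
        ring } C fun f => by
    refine Lp.norm_le_mul_norm_of_ae_le_mul ?_
    filter_upwards [(memLp_bounded_mul hφ hC f).coeFn_toLp, hC] with t h1 h2
    simp only [LinearMap.coe_mk, AddHom.coe_mk]
    rw [h1, norm_mul]
    gcongr

theorem coeFn_boundedMul {Γ : Measure ℝ} (φ : ℝ → ℂ) (hφ : AEStronglyMeasurable φ Γ) (C : ℝ)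
    (hC : ∀ᵐ t ∂Γ, ‖φ t‖ ≤ C) (f : Lp ℂ 2 Γ) :
    boundedMul φ hφ C hC f =ᵐ[Γ] fun t => φ t * f t :=
  (memLp_bounded_mul hφ hC f).coeFn_toLp

/-! ### The canonical deficiency vectors -/

theorem ofReal_add_I_ne_zero (t : ℝ) : (t : ℂ) + Complex.I ≠ 0 := by
  intro h
  simpa using congrArg Complex.im h

theorem ofReal_sub_I_ne_zero (t : ℝ) : (t : ℂ) - Complex.I ≠ 0 := by
  intro h
  simpa using congrArg Complex.im h

theorem norm_ofReal_add_I_sq (t : ℝ) : ‖(t : ℂ) + Complex.I‖ ^ 2 = 1 + t ^ 2 := by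
  rw [← Complex.normSq_eq_norm_sq, Complex.normSq_apply]
  simp
  ring

theorem norm_ofReal_sub_I (t : ℝ) : ‖(t : ℂ) - Complex.I‖ = ‖(t : ℂ) + Complex.I‖ := by
  rw [← Complex.norm_conj]
  simp

theorem continuous_inv_ofReal_add_I : Continuous fun t : ℝ => 1 / ((t : ℂ) + Complex.I) :=
  continuous_const.div (by fun_prop) ofReal_add_I_ne_zero

variable {Γ : Measure ℝ} (hΓ : IsHerglotz Γ)
include hΓ

theorem IsHerglotz.integrable_one_div : Integrable (fun t : ℝ => 1 / (1 + t ^ 2)) Γ := by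
  refine ⟨(continuous_const.div (by fun_prop) fun t => by positivity).aestronglyMeasurable, ?_⟩
  rw [hasFiniteIntegral_iff_ofReal (Eventually.of_forall fun t => by positivity)]
  exact hΓ

theorem coeFn_canonicalPlus : canonicalPlus hΓ =ᵐ[Γ] fun t : ℝ => 1 / ((t : ℂ) - Complex.I) := by
  refine (hΓ.memLp_cauchy (w := -Complex.I) (by simp)).coeFn_toLp.trans
    (Eventually.of_forall fun t => ?_)
  simp

theorem coeFn_canonicalMinus :
    canonicalMinus hΓ =ᵐ[Γ] fun t : ℝ => 1 / ((t : ℂ) + Complex.I) := by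
  refine (hΓ.memLp_cauchy (w := Complex.I) (by simp)).coeFn_toLp.trans
    (Eventually.of_forall fun t => ?_)
  simp

theorem norm_canonicalPlus_eq : ‖canonicalPlus hΓ‖ = ‖canonicalMinus hΓ‖ := by
  refine le_antisymm (Lp.norm_le_norm_of_ae_le ?_) (Lp.norm_le_norm_of_ae_le ?_) <;>
  · filter_upwards [coeFn_canonicalPlus hΓ, coeFn_canonicalMinus hΓ] with t h1 h2
    rw [h1, h2, norm_div, norm_div, norm_ofReal_sub_I]

theorem inner_canonicalPlus (f : Lp ℂ 2 Γ) :
    inner ℂ (canonicalPlus hΓ) f = ∫ t : ℝ, f t / ((t : ℂ) + Complex.I) ∂Γ := by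
  rw [L2.inner_def]
  refine integral_congr_ae ?_
  filter_upwards [coeFn_canonicalPlus hΓ] with t h
  rw [h, RCLike.inner_apply]
  simp [div_eq_mul_inv]

theorem norm_sq_canonicalPlus : ‖canonicalPlus hΓ‖ ^ 2 = ∫ t : ℝ, 1 / (1 + t ^ 2) ∂Γ := by
  have h := inner_self_eq_norm_sq_to_K (𝕜 := ℂ) (canonicalPlus hΓ)
  rw [inner_canonicalPlus] at h
  have h2 : ∫ t : ℝ, canonicalPlus hΓ t / ((t : ℂ) + Complex.I) ∂Γ
      = ∫ t : ℝ, ((1 / (1 + t ^ 2) : ℝ) : ℂ) ∂Γ := by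
    refine integral_congr_ae ?_
    filter_upwards [coeFn_canonicalPlus hΓ] with t h
    have e : ((t : ℂ) - Complex.I) * ((t : ℂ) + Complex.I) = 1 + (t : ℂ) ^ 2 := by
      linear_combination -Complex.I_sq
    rw [h, div_div, e]
    push_cast
    rfl
  rw [h2, integral_complex_ofReal] at h
  have h3 : ((‖canonicalPlus hΓ‖ ^ 2 : ℝ) : ℂ) = ((∫ t : ℝ, 1 / (1 + t ^ 2) ∂Γ : ℝ) : ℂ) := by
    rw [h]; push_cast; rfl
  exact_mod_cast h3

theorem canonicalPlus_ne_zero (h0 : Γ ≠ 0) : canonicalPlus hΓ ≠ 0 := by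
  intro h
  have h1 := coeFn_canonicalPlus hΓ
  rw [h] at h1
  have : ∀ᵐ t : ℝ ∂Γ, False := by
    filter_upwards [h1, Lp.coeFn_zero ℂ 2 Γ] with t h2 h3
    rw [h3] at h2
    exact one_div_ne_zero (ofReal_sub_I_ne_zero t) h2.symm
  rw [eventually_false_iff_eq_bot, ae_eq_bot] at this
  exact h0 this

/-! ### The operator and its Cayley transform -/

theorem mem_herglotzOperator_domain {f : Lp ℂ 2 Γ} :
    f ∈ (herglotzOperator hΓ).domain ↔ f ∈ mulDomain Γ ∧ ∫ t, f t ∂Γ = 0 := by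
  constructor
  · intro h
    exact h.1
  · intro h
    exact ⟨h, h.1⟩

theorem coeFn_herglotzOperator (x : (herglotzOperator hΓ).domain) :
    herglotzOperator hΓ x =ᵐ[Γ] fun t : ℝ => (t : ℂ) * (x : Lp ℂ 2 Γ) t :=
  (mulDomain.memLp ((mem_herglotzOperator_domain hΓ).1 x.2).1).coeFn_toLp

theorem canonicalPlus_mem_deficiencySpace :
    canonicalPlus hΓ ∈ deficiencySpace (herglotzOperator hΓ) Complex.I := by
  intro y
  rw [← inner_conj_symm, inner_canonicalPlus]
  have h : ∫ t : ℝ, (herglotzOperator hΓ y - (starRingEnd ℂ) Complex.I • (y : Lp ℂ 2 Γ) :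
      Lp ℂ 2 Γ) t / ((t : ℂ) + Complex.I) ∂Γ = ∫ t, (y : Lp ℂ 2 Γ) t ∂Γ := by
    refine integral_congr_ae ?_
    filter_upwards [coeFn_herglotzOperator hΓ y, Lp.coeFn_sub (herglotzOperator hΓ y)
      ((starRingEnd ℂ) Complex.I • (y : Lp ℂ 2 Γ)),
      Lp.coeFn_smul ((starRingEnd ℂ) Complex.I) (y : Lp ℂ 2 Γ)] with t h1 h2 h3
    rw [h2, Pi.sub_apply, h1, h3, Pi.smul_apply, smul_eq_mul, Complex.conj_I,
      div_eq_iff (ofReal_add_I_ne_zero t)]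
    ring
  rw [h, ((mem_herglotzOperator_domain hΓ).1 y.2).2, map_zero]

theorem canonicalMinus_mem_deficiencySpace :
    canonicalMinus hΓ ∈ deficiencySpace (herglotzOperator hΓ) (-Complex.I) := by
  intro y
  rw [← inner_conj_symm, L2.inner_def]
  have h : ∫ t : ℝ, inner ℂ (canonicalMinus hΓ t)
      ((herglotzOperator hΓ y - (starRingEnd ℂ) (-Complex.I) • (y : Lp ℂ 2 Γ) :
      Lp ℂ 2 Γ) t) ∂Γ = ∫ t, (y : Lp ℂ 2 Γ) t ∂Γ := by
    refine integral_congr_ae ?_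
    filter_upwards [coeFn_herglotzOperator hΓ y, Lp.coeFn_sub (herglotzOperator hΓ y)
      ((starRingEnd ℂ) (-Complex.I) • (y : Lp ℂ 2 Γ)), coeFn_canonicalMinus hΓ,
      Lp.coeFn_smul ((starRingEnd ℂ) (-Complex.I)) (y : Lp ℂ 2 Γ)] with t h1 h2 h4 h3
    rw [h2, Pi.sub_apply, h1, h3, h4, Pi.smul_apply, smul_eq_mul, RCLike.inner_apply]
    simp only [map_neg, Complex.conj_I, neg_neg, map_div₀, map_one, map_add, Complex.conj_ofReal]
    rw [mul_one_div, div_eq_iff (by simpa [sub_eq_add_neg] using ofReal_sub_I_ne_zero t)]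
    ring
  rw [h, ((mem_herglotzOperator_domain hΓ).1 y.2).2, map_zero]

theorem isDeficiencyPair_canonical (h0 : Γ ≠ 0) :
    IsDeficiencyPair (herglotzOperator hΓ) (canonicalPlus hΓ) (canonicalMinus hΓ) :=
  ⟨canonicalPlus_mem_deficiencySpace hΓ, canonicalMinus_mem_deficiencySpace hΓ,
    canonicalPlus_ne_zero hΓ h0, norm_canonicalPlus_eq hΓ⟩

/-- `Ran (T + i)` contains the orthogonal complement of `φ₊`. -/
theorem exists_herglotzOperator_add_I_eq {f : Lp ℂ 2 Γ}
    (hf : inner ℂ (canonicalPlus hΓ) f = 0) :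
    ∃ x : (herglotzOperator hΓ).domain, herglotzOperator hΓ x + Complex.I • (x : Lp ℂ 2 Γ) = f := by
  have hb : ∀ᵐ t : ℝ ∂Γ, ‖1 / ((t : ℂ) + Complex.I)‖ ≤ 1 := Eventually.of_forall fun t => by
    have h1 := norm_ofReal_add_I_sq t
    have h2 : 1 ≤ ‖(t : ℂ) + Complex.I‖ := by nlinarith [norm_nonneg ((t : ℂ) + Complex.I)]
    rw [norm_div, norm_one]
    exact (div_le_one (by linarith)).2 h2
  -- Dividing by t + i inverts T + i. The integral of f/(t + i) is ⟨φ₊, f⟩, so orthogonality to φ₊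
  -- is exactly the mean-zero condition of the domain.
  set x := boundedMul _ continuous_inv_ofReal_add_I.aestronglyMeasurable 1 hb f with hx
  have hx' := coeFn_boundedMul _ continuous_inv_ofReal_add_I.aestronglyMeasurable 1 hb f
  rw [← hx] at hx'
  have hdom : x ∈ (herglotzOperator hΓ).domain := by
    rw [mem_herglotzOperator_domain]
    constructor
    · refine (memLp_congr_ae ?_).1 ((Lp.memLp f).sub ((Lp.memLp x).const_mul Complex.I))
      filter_upwards [hx'] with t h
      rw [Pi.sub_apply, h]
      have := ofReal_add_I_ne_zero t
      field_simp
      ring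
    · rw [inner_canonicalPlus] at hf
      rw [← hf]
      refine integral_congr_ae ?_
      filter_upwards [hx'] with t h
      rw [h]
      ring
  refine ⟨⟨x, hdom⟩, Lp.ext ?_⟩
  filter_upwards [hx', coeFn_herglotzOperator hΓ ⟨x, hdom⟩,
    Lp.coeFn_add (herglotzOperator hΓ ⟨x, hdom⟩) (Complex.I • x), Lp.coeFn_smul Complex.I x]
    with t h1 h2 h3 h4
  rw [h3, Pi.add_apply, h2, h4, Pi.smul_apply, smul_eq_mul, h1]
  have := ofReal_add_I_ne_zero t
  field_simp

theorem inner_canonicalPlus_self :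
    inner ℂ (canonicalPlus hΓ) (canonicalPlus hΓ) = (‖canonicalPlus hΓ‖ : ℂ) ^ 2 :=
  inner_self_eq_norm_sq_to_K (𝕜 := ℂ) (canonicalPlus hΓ)

theorem norm_canonicalPlus_sq_ne_zero (h0 : Γ ≠ 0) : (‖canonicalPlus hΓ‖ : ℂ) ^ 2 ≠ 0 := by
  simpa using canonicalPlus_ne_zero hΓ h0

theorem inner_canonicalPlus_herglotzOperator (x : (herglotzOperator hΓ).domain) :
    inner ℂ (canonicalPlus hΓ) (herglotzOperator hΓ x + Complex.I • (x : Lp ℂ 2 Γ)) = 0 := by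
  have h := canonicalPlus_mem_deficiencySpace hΓ x
  rw [Complex.conj_I, neg_smul, sub_neg_eq_add] at h
  rw [← inner_conj_symm, h, map_zero]

/-- The part of g orthogonal to φ₊ lies in Ran(T + i), to which both g and φ₊ are orthogonal, so it
is orthogonal to itself. -/
theorem deficiencySpace_I_eq_smul (h0 : Γ ≠ 0) {g : Lp ℂ 2 Γ}
    (hg : g ∈ deficiencySpace (herglotzOperator hΓ) Complex.I) :
    g = (inner ℂ (canonicalPlus hΓ) g / (‖canonicalPlus hΓ‖ : ℂ) ^ 2) • canonicalPlus hΓ := by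
  have hK := norm_canonicalPlus_sq_ne_zero hΓ h0
  set c := inner ℂ (canonicalPlus hΓ) g / (‖canonicalPlus hΓ‖ : ℂ) ^ 2 with hc
  have h1 : inner ℂ (canonicalPlus hΓ) (g - c • canonicalPlus hΓ) = 0 := by
    rw [inner_sub_right, inner_smul_right, inner_canonicalPlus_self, hc, div_mul_cancel₀ _ hK,
      sub_self]
  obtain ⟨x, hx⟩ := exists_herglotzOperator_add_I_eq hΓ h1
  have h2 := hg x
  rw [Complex.conj_I, neg_smul, sub_neg_eq_add, hx] at h2
  have h3 : inner ℂ (g - c • canonicalPlus hΓ) (g - c • canonicalPlus hΓ) = 0 := by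
    conv_lhs => rw [inner_sub_right, inner_smul_right, h2]
    rw [← inner_conj_symm, h1]
    simp
  exact sub_eq_zero.1 (inner_self_eq_zero.1 h3)

omit hΓ in
theorem continuous_cayley :
    Continuous fun t : ℝ => ((t : ℂ) - Complex.I) / ((t : ℂ) + Complex.I) :=
  Continuous.div (by fun_prop) (by fun_prop) ofReal_add_I_ne_zero

omit hΓ in
variable (Γ) in
/-- Multiplication by `(t - i) / (t + i)`, the Cayley transform of `M^Γ`. -/
def cayleyMul : Lp ℂ 2 Γ →L[ℂ] Lp ℂ 2 Γ :=
  boundedMul (fun t : ℝ => ((t : ℂ) - Complex.I) / ((t : ℂ) + Complex.I))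
    continuous_cayley.aestronglyMeasurable 1 (Eventually.of_forall fun t => by
      rw [norm_div, norm_ofReal_sub_I]
      exact div_self_le_one _)

omit hΓ in
theorem coeFn_cayleyMul (f : Lp ℂ 2 Γ) :
    cayleyMul Γ f =ᵐ[Γ] fun t : ℝ => ((t : ℂ) - Complex.I) / ((t : ℂ) + Complex.I) * f t :=
  coeFn_boundedMul _ _ _ _ f

theorem cayleyMul_canonicalPlus : cayleyMul Γ (canonicalPlus hΓ) = canonicalMinus hΓ := by
  refine Lp.ext ?_
  filter_upwards [coeFn_cayleyMul (canonicalPlus hΓ), coeFn_canonicalPlus hΓ,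
    coeFn_canonicalMinus hΓ] with t h1 h2 h3
  rw [h1, h2, h3]
  have := ofReal_sub_I_ne_zero t
  have := ofReal_add_I_ne_zero t
  field_simp

theorem cayleyMul_herglotzOperator (x : (herglotzOperator hΓ).domain) :
    cayleyMul Γ (herglotzOperator hΓ x + Complex.I • (x : Lp ℂ 2 Γ)) =
      herglotzOperator hΓ x - Complex.I • (x : Lp ℂ 2 Γ) := by
  refine Lp.ext ?_
  filter_upwards [coeFn_cayleyMul (herglotzOperator hΓ x + Complex.I • (x : Lp ℂ 2 Γ)),
    coeFn_herglotzOperator hΓ x,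
    Lp.coeFn_add (herglotzOperator hΓ x) (Complex.I • (x : Lp ℂ 2 Γ)),
    Lp.coeFn_sub (herglotzOperator hΓ x) (Complex.I • (x : Lp ℂ 2 Γ)),
    Lp.coeFn_smul Complex.I (x : Lp ℂ 2 Γ)] with t h1 h2 h3 h4 h5
  rw [h1, h3, h4, Pi.add_apply, Pi.sub_apply, h2, h5, Pi.smul_apply, smul_eq_mul]
  have := ofReal_add_I_ne_zero t
  field_simp

/-- `cayleyMul` agrees with V on Ran(T + i) and maps φ₊ to φ₋, whereas V kills φ₊; subtracting the
φ₊ component accounts for the difference. -/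
theorem mem_cayleyGraph_iff (h0 : Γ ≠ 0) (f v : Lp ℂ 2 Γ) :
    (f, v) ∈ cayleyGraph (herglotzOperator hΓ) ↔ v = cayleyMul Γ f -
      (inner ℂ (canonicalPlus hΓ) f / (‖canonicalPlus hΓ‖ : ℂ) ^ 2) • canonicalMinus hΓ := by
  have hK := norm_canonicalPlus_sq_ne_zero hΓ h0
  constructor
  · rintro ⟨x, g, hg, h⟩
    obtain ⟨h1, h2⟩ := Prod.mk.inj h
    have hg' := deficiencySpace_I_eq_smul hΓ h0 hg
    rw [h2, h1, inner_add_right, inner_canonicalPlus_herglotzOperator, zero_add, map_add,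
      cayleyMul_herglotzOperator]
    conv_rhs => rw [hg']
    rw [map_smul, cayleyMul_canonicalPlus, inner_smul_right, inner_canonicalPlus_self,
      div_mul_cancel₀ _ hK, add_sub_cancel_right]
  · rintro rfl
    set c := inner ℂ (canonicalPlus hΓ) f / (‖canonicalPlus hΓ‖ : ℂ) ^ 2 with hc
    have h1 : inner ℂ (canonicalPlus hΓ) (f - c • canonicalPlus hΓ) = 0 := by
      rw [inner_sub_right, inner_smul_right, inner_canonicalPlus_self, hc, div_mul_cancel₀ _ hK,
        sub_self]
    obtain ⟨x, hx⟩ := exists_herglotzOperator_add_I_eq hΓ h1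
    refine ⟨x, c • canonicalPlus hΓ, fun y => ?_, ?_⟩
    · rw [inner_smul_right, canonicalPlus_mem_deficiencySpace hΓ y, mul_zero]
    · rw [hx, sub_add_cancel, ← cayleyMul_herglotzOperator, hx, map_sub, map_smul,
        cayleyMul_canonicalPlus]

/-- The unitary extension `U(α)` as a bounded operator. -/
def unitaryExtension (α : ℂ) : Lp ℂ 2 Γ →L[ℂ] Lp ℂ 2 Γ :=
  cayleyMul Γ + ((α - 1) / (‖canonicalPlus hΓ‖ : ℂ) ^ 2) •
    (innerSL ℂ (canonicalPlus hΓ)).smulRight (canonicalMinus hΓ)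

theorem unitaryExtension_apply (α : ℂ) (f : Lp ℂ 2 Γ) :
    unitaryExtension hΓ α f = cayleyMul Γ f +
      ((α - 1) / (‖canonicalPlus hΓ‖ : ℂ) ^ 2 * inner ℂ (canonicalPlus hΓ) f) •
        canonicalMinus hΓ := by
  simp [unitaryExtension, smul_smul]

theorem mem_unitaryExtensionGraph_iff (h0 : Γ ≠ 0) (α : ℂ) (f u : Lp ℂ 2 Γ) :
    (f, u) ∈ unitaryExtensionGraph (herglotzOperator hΓ) (canonicalPlus hΓ) (canonicalMinus hΓ) α
      ↔ u = unitaryExtension hΓ α f := by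
  simp only [unitaryExtensionGraph, mem_ofPred_eq, mem_cayleyGraph_iff hΓ h0, exists_eq_left,
    unitaryExtension_apply]
  rw [← sub_eq_zero, ← sub_eq_zero (b := _ + _)]
  -- This turns the equivalence of two equations into an identity of vectors, which `module`
  -- decides.
  have : ∀ a b : Lp ℂ 2 Γ, a = b → (a = 0 ↔ b = 0) := by rintro a _ rfl; rfl
  apply this
  module

/-- `(i - z) + (i + z) U(α)`, which is injective exactly when `z` is not an eigenvalue. -/
def characteristicOperator (α z : ℂ) : Lp ℂ 2 Γ →L[ℂ] Lp ℂ 2 Γ :=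
  (Complex.I - z) • ContinuousLinearMap.id ℂ _ + (Complex.I + z) • unitaryExtension hΓ α

/-- Over the common denominator t + i, the diagonal part is (i - z)(t + i) + (i + z)(t - i) = 2i(t -
z). -/
theorem coeFn_characteristicOperator (α z : ℂ) (f : Lp ℂ 2 Γ) :
    characteristicOperator hΓ α z f =ᵐ[Γ] fun t : ℝ =>
      (2 * Complex.I * ((t : ℂ) - z) * f t + (Complex.I + z) * (α - 1) *
        (inner ℂ (canonicalPlus hΓ) f / (‖canonicalPlus hΓ‖ : ℂ) ^ 2)) /
          ((t : ℂ) + Complex.I) := by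
  have h : characteristicOperator hΓ α z f = (Complex.I - z) • f + ((Complex.I + z) • cayleyMul Γ f
      + ((Complex.I + z) * ((α - 1) / (‖canonicalPlus hΓ‖ : ℂ) ^ 2 *
        inner ℂ (canonicalPlus hΓ) f)) • canonicalMinus hΓ) := by
    simp only [characteristicOperator, add_apply,
      smul_apply, ContinuousLinearMap.id_apply, unitaryExtension_apply]
    module
  rw [h]
  refine (Lp.coeFn_add _ _).trans ?_
  filter_upwards [Lp.coeFn_smul (Complex.I - z) f, Lp.coeFn_add ((Complex.I + z) • cayleyMul Γ f)
    (((Complex.I + z) * ((α - 1) / (‖canonicalPlus hΓ‖ : ℂ) ^ 2 *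
        inner ℂ (canonicalPlus hΓ) f)) • canonicalMinus hΓ),
    Lp.coeFn_smul (Complex.I + z) (cayleyMul Γ f), coeFn_cayleyMul f, coeFn_canonicalMinus hΓ,
    Lp.coeFn_smul ((Complex.I + z) * ((α - 1) / (‖canonicalPlus hΓ‖ : ℂ) ^ 2 *
        inner ℂ (canonicalPlus hΓ) f)) (canonicalMinus hΓ)] with t h1 h2 h3 h4 h5 h6
  rw [Pi.add_apply, h1, h2, Pi.add_apply, h3, h6, Pi.smul_apply, Pi.smul_apply, Pi.smul_apply, h4,
    h5]
  simp only [smul_eq_mul]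
  rw [eq_div_iff (ofReal_add_I_ne_zero t)]
  have := ofReal_add_I_ne_zero t
  rw [← mul_assoc, add_mul, add_mul, mul_one_div, div_mul_cancel₀ _ this]
  have e2 : (Complex.I + z) * (((t : ℂ) - Complex.I) / ((t : ℂ) + Complex.I) * f t) *
      ((t : ℂ) + Complex.I) = (Complex.I + z) * ((t : ℂ) - Complex.I) * f t := by
    field_simp
  rw [← mul_assoc] at e2
  rw [e2]
  ring

theorem mem_extensionGraph_iff (h0 : Γ ≠ 0) (θ : ℝ) (z : ℂ) (x y : Lp ℂ 2 Γ) :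
    (x, y + z • x) ∈ extensionGraph (herglotzOperator hΓ) (canonicalPlus hΓ) (canonicalMinus hΓ) θ
      ↔ ∃ f, x = f - unitaryExtension hΓ (Complex.exp (2 * Real.pi * Complex.I * θ)) f ∧
        y = characteristicOperator hΓ (Complex.exp (2 * Real.pi * Complex.I * θ)) z f := by
  simp only [extensionGraph, mem_ofPred_eq, mem_unitaryExtensionGraph_iff hΓ h0, exists_eq_left,
    Prod.mk.injEq, characteristicOperator, add_apply,
      smul_apply, ContinuousLinearMap.id_apply]
  refine exists_congr fun f => and_congr_right fun hx => ?_
  rw [hx, ← eq_sub_iff_add_eq]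
  have : ∀ a b y : Lp ℂ 2 Γ, a = b → (y = a ↔ y = b) := by rintro a _ _ rfl; rfl
  apply this
  module

/-- The resolvent is (1 - U) composed with the inverse of the characteristic operator, which is
bounded by the open mapping theorem. -/
theorem notMem_graphSpectrum_of_bijective (h0 : Γ ≠ 0) {θ : ℝ} {z : ℂ}
    (hb : Function.Bijective
      (characteristicOperator hΓ (Complex.exp (2 * Real.pi * Complex.I * θ)) z)) :
    z ∉ graphSpectrum (extensionGraph (herglotzOperator hΓ) (canonicalPlus hΓ)
      (canonicalMinus hΓ) θ) := by
  set α := Complex.exp (2 * Real.pi * Complex.I * θ) with hα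
  rw [graphSpectrum, mem_ofPred_eq, not_not]
  let e := ContinuousLinearEquiv.ofBijective (characteristicOperator hΓ α z)
    (LinearMap.ker_eq_bot.2 hb.1) (LinearMap.range_eq_top.2 hb.2)
  refine ⟨(ContinuousLinearMap.id ℂ _ - unitaryExtension hΓ α) ∘L
    (e.symm : Lp ℂ 2 Γ →L[ℂ] Lp ℂ 2 Γ), fun x y => ?_⟩
  rw [mem_extensionGraph_iff hΓ h0, ← hα]
  constructor
  · rintro ⟨f, hx, hy⟩
    have : e.symm y = f := by
      rw [ContinuousLinearEquiv.symm_apply_eq]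
      exact hy
    simp [this, hx]
  · intro h
    refine ⟨e.symm y, ?_, (e.apply_symm_apply y).symm⟩
    rw [← h]
    simp

/-- A kernel vector puts ((1 - U)f, 0) in the graph of T_θ - z, so a resolvent would force Uf = f.
The characteristic operator then acts on f as 2i. The argument also covers the case of a linear
relation. -/
theorem mem_graphSpectrum_of_apply_eq_zero (h0 : Γ ≠ 0) {θ : ℝ} {z : ℂ} {f : Lp ℂ 2 Γ}
    (hf : f ≠ 0)
    (h : characteristicOperator hΓ (Complex.exp (2 * Real.pi * Complex.I * θ)) z f = 0) :
    z ∈ graphSpectrum (extensionGraph (herglotzOperator hΓ) (canonicalPlus hΓ)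
      (canonicalMinus hΓ) θ) := by
  set α := Complex.exp (2 * Real.pi * Complex.I * θ) with hα
  rintro ⟨R, hR⟩
  have h1 := (hR (f - unitaryExtension hΓ α f) 0).1
    ((mem_extensionGraph_iff hΓ h0 _ _ _ _).2 ⟨f, rfl, h.symm⟩)
  rw [map_zero, eq_comm, sub_eq_zero] at h1
  simp only [characteristicOperator, add_apply,
    smul_apply, ContinuousLinearMap.id_apply, ← h1] at h
  rw [← add_smul, smul_eq_zero] at h
  refine h.elim (fun h => ?_) hf
  have : (2 : ℂ) * Complex.I = 0 := by linear_combination h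
  simp at this

end

/-! ### Atomic measures and the spectrum of the extensions -/

noncomputable section

section Atomic

variable {ι : Type*} {t w : ι → ℝ}

/-- Positive weights make the a.e. filter the supremum of the principal filters at the atoms.
Elements of L² can therefore be evaluated and compared atom by atom. -/
theorem ae_atomicMeasure_iff [Countable ι] (hw : ∀ n, 0 < w n) {P : ℝ → Prop} :
    (∀ᵐ x ∂atomicMeasure t w, P x) ↔ ∀ n, P (t n) := by
  have h : ae (atomicMeasure t w) = ⨆ n, pure (t n) := by
    rw [atomicMeasure, Measure.ae_sum_eq]
    refine iSup_congr fun n => ?_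
    rw [Measure.ae_ennreal_smul_measure_eq (by simpa using hw n), ae_dirac_eq]
  rw [h, eventually_iSup]
  simp

theorem atomicMeasure_real_singleton (hw : ∀ n, 0 < w n) (ht : Function.Injective t) (n : ι) :
    (atomicMeasure t w).real {t n} = w n := by
  rw [measureReal_def, atomicMeasure, Measure.sum_apply _ (measurableSet_singleton _),
    tsum_eq_single n]
  · simp [(hw n).le]
  · intro k hk
    simp [ht.eq_iff, hk]

theorem atomicMeasure_singleton_eq_zero [Countable ι] (hw : ∀ n, 0 < w n) {x : ℝ}
    (hx : x ∉ range t) :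
    atomicMeasure t w {x} = 0 := by
  have : ∀ᵐ y ∂atomicMeasure t w, y ≠ x :=
    (ae_atomicMeasure_iff hw).2 fun n h => hx ⟨n, h⟩
  simpa [ae_iff] using this

theorem atomicMeasure_singleton_ne_top (x : ℝ) (ht : Function.Injective t) :
    atomicMeasure t w {x} ≠ ⊤ := by
  rw [atomicMeasure, Measure.sum_apply _ (measurableSet_singleton _)]
  by_cases hx : x ∈ range t
  · obtain ⟨n, rfl⟩ := hx
    rw [tsum_eq_single n]
    · simp
    · intro k hk
      simp [ht.eq_iff, hk]
  · have : ∀ k, t k ≠ x := fun k h => hx ⟨k, h⟩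
    simp [this]

theorem atomicMeasure_ne_zero [Countable ι] [Nonempty ι] (hw : ∀ n, 0 < w n) :
    atomicMeasure t w ≠ 0 := by
  intro h
  have : ∀ᵐ x ∂atomicMeasure t w, False := by simp [h]
  exact (ae_atomicMeasure_iff hw).1 this (Classical.arbitrary ι)

end Atomic

theorem exists_pos_le_dist_of_not_accPt {S : Set ℝ} {p : ℝ} (h : ¬ AccPt p (𝓟 S)) :
    ∃ δ > 0, ∀ x ∈ S, x ≠ p → δ ≤ |x - p| := by
  rw [accPt_iff_frequently_nhdsNE, not_frequently, eventually_nhdsWithin_iff,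
    Metric.eventually_nhds_iff] at h
  obtain ⟨δ, hδ, h⟩ := h
  refine ⟨δ, hδ, fun x hx hxp => ?_⟩
  by_contra! hlt
  exact h (by rwa [Real.dist_eq]) hxp hx

/-- Write x + i = (x - z) + (z + i), with |x - z| bounded below on S \ {z}. If z itself lies in S,
division by zero gives the value 0 there, so the bound survives at an atom. -/
theorem exists_norm_div_sub_le {S : Set ℝ} (hS : ∀ p : ℝ, ¬ AccPt p (𝓟 S)) (z : ℂ) :
    ∃ C : ℝ, ∀ x ∈ S, ‖((x : ℂ) + Complex.I) / ((x : ℂ) - z)‖ ≤ C := by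
  obtain ⟨δ, hδ, h⟩ : ∃ δ > 0, ∀ x ∈ S, (x : ℂ) ≠ z → δ ≤ ‖(x : ℂ) - z‖ := by
    by_cases hz : z.im = 0
    · obtain ⟨δ, hδ, h⟩ := exists_pos_le_dist_of_not_accPt (hS z.re)
      have hz' : z = (z.re : ℂ) := Complex.ext rfl (by simp [hz])
      refine ⟨δ, hδ, fun x hx hxz => ?_⟩
      rw [hz'] at hxz ⊢
      rw [← Complex.ofReal_sub, Complex.norm_real]
      exact h x hx (by exact_mod_cast hxz)
    · refine ⟨|z.im|, abs_pos.2 hz, fun x _ _ => ?_⟩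
      have := Complex.abs_im_le_norm ((x : ℂ) - z)
      simpa using this
  refine ⟨1 + ‖z + Complex.I‖ / δ, fun x hx => ?_⟩
  by_cases hxz : (x : ℂ) = z
  · rw [hxz, sub_self, div_zero, norm_zero]
    positivity
  · have h1 := h x hx hxz
    have h2 : ‖(x : ℂ) + Complex.I‖ ≤ ‖(x : ℂ) - z‖ + ‖z + Complex.I‖ := by
      have := norm_add_le ((x : ℂ) - z) (z + Complex.I)
      rwa [show (x : ℂ) - z + (z + Complex.I) = (x : ℂ) + Complex.I by ring] at this
    rw [norm_div, div_le_iff₀ (by linarith)]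
    have h3 : ‖z + Complex.I‖ ≤ ‖z + Complex.I‖ / δ * ‖(x : ℂ) - z‖ := by
      rw [div_mul_eq_mul_div, le_div_iff₀ hδ]
      gcongr
    linarith

/-! ### Solving the characteristic equation coordinatewise -/

section Spectrum

variable {ι : Type*} [Countable ι] {t w : ι → ℝ} (hw : ∀ n, 0 < w n)
include hw

theorem Lp_atomicMeasure_ext {f g : Lp ℂ 2 (atomicMeasure t w)} (h : ∀ n, f (t n) = g (t n)) :
    f = g :=
  Lp.ext ((ae_atomicMeasure_iff hw).2 h)

variable (hacc : ∀ p : ℝ, ¬ AccPt p (𝓟 (range t)))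
include hacc

theorem exists_ae_norm_div_sub_le (z : ℂ) :
    ∃ C : ℝ, ∀ᵐ x : ℝ ∂atomicMeasure t w, ‖((x : ℂ) + Complex.I) / ((x : ℂ) - z)‖ ≤ C := by
  obtain ⟨C, hC⟩ := exists_norm_div_sub_le hacc z
  exact ⟨C, (ae_atomicMeasure_iff hw).2 fun n => hC _ ⟨n, rfl⟩⟩

omit [Countable ι] hw hacc in
theorem measurable_add_I_div_sub (z : ℂ) :
    Measurable fun x : ℝ => ((x : ℂ) + Complex.I) / ((x : ℂ) - z) := by
  fun_prop

/-- Multiplication by `(x + i) / (x - z)` on `L²` of an atomic measure with discrete support. -/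
def resolventMul (z : ℂ) : Lp ℂ 2 (atomicMeasure t w) →L[ℂ] Lp ℂ 2 (atomicMeasure t w) :=
  boundedMul (fun x : ℝ => ((x : ℂ) + Complex.I) / ((x : ℂ) - z))
    (measurable_add_I_div_sub z).aestronglyMeasurable _
    (exists_ae_norm_div_sub_le hw hacc z).choose_spec

theorem resolventMul_apply (z : ℂ) (f : Lp ℂ 2 (atomicMeasure t w)) (n : ι) :
    resolventMul hw hacc z f (t n) = ((t n : ℂ) + Complex.I) / ((t n : ℂ) - z) * f (t n) :=
  (ae_atomicMeasure_iff hw).1 (coeFn_boundedMul _ _ _ _ f) n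

variable (hΓ : IsHerglotz (atomicMeasure t w))

omit hacc in
theorem canonicalMinus_apply (n : ι) : canonicalMinus hΓ (t n) = 1 / ((t n : ℂ) + Complex.I) :=
  (ae_atomicMeasure_iff hw).1 (coeFn_canonicalMinus hΓ) n

omit hacc in
theorem characteristicOperator_apply (α z : ℂ) (f : Lp ℂ 2 (atomicMeasure t w)) (n : ι) :
    characteristicOperator hΓ α z f (t n) =
      (2 * Complex.I * ((t n : ℂ) - z) * f (t n) + (Complex.I + z) * (α - 1) *
        (inner ℂ (canonicalPlus hΓ) f / (‖canonicalPlus hΓ‖ : ℂ) ^ 2)) /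
          ((t n : ℂ) + Complex.I) :=
  (ae_atomicMeasure_iff hw).1 (coeFn_characteristicOperator hΓ α z f) n

omit hacc in
theorem add_apply_atom (f g : Lp ℂ 2 (atomicMeasure t w)) (n : ι) :
    (f + g : Lp ℂ 2 (atomicMeasure t w)) (t n) = f (t n) + g (t n) :=
  (ae_atomicMeasure_iff hw).1 (Lp.coeFn_add f g) n

omit hacc in
theorem smul_apply_atom (c : ℂ) (f : Lp ℂ 2 (atomicMeasure t w)) (n : ι) :
    (c • f : Lp ℂ 2 (atomicMeasure t w)) (t n) = c * f (t n) :=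
  (ae_atomicMeasure_iff hw).1 (Lp.coeFn_smul c f) n

omit hacc in
theorem zero_apply_atom (n : ι) : (0 : Lp ℂ 2 (atomicMeasure t w)) (t n) = 0 :=
  (ae_atomicMeasure_iff hw).1 (Lp.coeFn_zero ℂ 2 (atomicMeasure t w)) n

/-- The vector `1 / (x - z)`, with value `0` at `z`. -/
def resolventVector (z : ℂ) : Lp ℂ 2 (atomicMeasure t w) :=
  resolventMul hw hacc z (canonicalMinus hΓ)

theorem resolventVector_apply (z : ℂ) (n : ι) :
    resolventVector hw hacc hΓ z (t n) = 1 / ((t n : ℂ) - z) := by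
  rw [resolventVector, resolventMul_apply, canonicalMinus_apply hw]
  have := ofReal_add_I_ne_zero (t n)
  rw [div_mul_div_comm, mul_one, mul_comm ((t n : ℂ) - z), div_mul_cancel_left₀ this, one_div]

omit [Countable ι] hw hacc in
/-- The Nevanlinna function `m(z) = ∫ (1 / (x - z) - x / (1 + x²)) dΓ(x)`. -/
def nevanlinna (Γ : Measure ℝ) (z : ℂ) : ℂ :=
  ∫ x : ℝ, (1 / ((x : ℂ) - z) - (x : ℂ) / (1 + (x : ℂ) ^ 2)) ∂Γ

/-- Both claims integrate the identity (z + i)/((x - z)(x + i)) = 1/(x - z) - x/(1 + x²) + i/(1 +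
x²). -/
theorem integrable_nevanlinna {z : ℂ} (hz : ∀ n, (t n : ℂ) ≠ z) :
    Integrable (fun x : ℝ => 1 / ((x : ℂ) - z) - (x : ℂ) / (1 + (x : ℂ) ^ 2)) (atomicMeasure t w) ∧
    (z + Complex.I) * inner ℂ (canonicalPlus hΓ) (resolventVector hw hacc hΓ z) =
      nevanlinna (atomicMeasure t w) z + Complex.I * (‖canonicalPlus hΓ‖ : ℂ) ^ 2 := by
  have h1 : Integrable (fun x : ℝ => resolventVector hw hacc hΓ z x / ((x : ℂ) + Complex.I))
      (atomicMeasure t w) := by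
    refine ((Lp.memLp (resolventVector hw hacc hΓ z)).integrable_mul
      (Lp.memLp (canonicalMinus hΓ))).congr ?_
    filter_upwards [coeFn_canonicalMinus hΓ] with x hx
    rw [Pi.mul_apply, hx, mul_one_div]
  have h2 : Integrable (fun x : ℝ => Complex.I * ((1 / (1 + x ^ 2) : ℝ) : ℂ))
    (atomicMeasure t w) := hΓ.integrable_one_div.ofReal.const_mul _
  have h3 : (fun x : ℝ => 1 / ((x : ℂ) - z) - (x : ℂ) / (1 + (x : ℂ) ^ 2)) =ᵐ[atomicMeasure t w]
      fun x : ℝ => (z + Complex.I) * (resolventVector hw hacc hΓ z x / ((x : ℂ) + Complex.I)) -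
        Complex.I * ((1 / (1 + x ^ 2) : ℝ) : ℂ) := by
    refine (ae_atomicMeasure_iff hw).2 fun n => ?_
    simp only [resolventVector_apply]
    have e1 := ofReal_add_I_ne_zero (t n)
    have e2 := sub_ne_zero.2 (hz n)
    have e3 := ofReal_sub_I_ne_zero (t n)
    have e4 : 1 + (t n : ℂ) ^ 2 = ((t n : ℂ) + Complex.I) * ((t n : ℂ) - Complex.I) := by
      linear_combination Complex.I_sq
    push_cast
    rw [e4]
    field_simp
    ring
  have h4 : Integrable (fun x : ℝ => (z + Complex.I) *
      (resolventVector hw hacc hΓ z x / ((x : ℂ) + Complex.I)) -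
        Complex.I * ((1 / (1 + x ^ 2) : ℝ) : ℂ)) (atomicMeasure t w) := (h1.const_mul _).sub h2
  refine ⟨h4.congr h3.symm, ?_⟩
  rw [nevanlinna, integral_congr_ae h3, integral_sub (h1.const_mul _) h2, integral_const_mul,
    integral_const_mul, integral_complex_ofReal, ← norm_sq_canonicalPlus hΓ, inner_canonicalPlus]
  push_cast
  ring

variable [Nonempty ι]

theorem characteristicOperator_bijective_of_ne {α z : ℂ} (hz : ∀ n, (t n : ℂ) ≠ z)
    (hΔ : (1 - α) * nevanlinna (atomicMeasure t w) z ≠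
      Complex.I * (1 + α) * (‖canonicalPlus hΓ‖ : ℂ) ^ 2) :
    Function.Bijective (characteristicOperator hΓ α z) := by
  have hK := norm_canonicalPlus_sq_ne_zero hΓ (atomicMeasure_ne_zero hw)
  set K : ℂ := (‖canonicalPlus hΓ‖ : ℂ) ^ 2 with hKdef
  have hq := (integrable_nevanlinna hw hacc hΓ hz).2
  rw [← hKdef] at hq
  set ψ := resolventVector hw hacc hΓ z with hψ
  set q : ℂ := inner ℂ (canonicalPlus hΓ) ψ with hqdef
  -- This is the determinant of the rank-one problem: solving for f in terms of c = ⟨φ₊, f⟩/K and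
  -- pairing with φ₊ leaves one scalar equation for c, with this coefficient.
  have hD : 2 * Complex.I * K + (Complex.I + z) * (α - 1) * q ≠ 0 := by
    intro h
    apply hΔ
    linear_combination (α - 1) * hq - h
  constructor
  · refine (injective_iff_map_eq_zero _).2 fun f hf => ?_
    set c : ℂ := inner ℂ (canonicalPlus hΓ) f / K with hc
    have h1 : (2 * Complex.I) • f = (-((Complex.I + z) * (α - 1) * c)) • ψ := by
      refine Lp_atomicMeasure_ext hw fun n => ?_
      have h2 := characteristicOperator_apply hw hΓ α z f n
      rw [hf, zero_apply_atom hw, eq_comm, div_eq_zero_iff, or_iff_left (ofReal_add_I_ne_zero _),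
        ← hc] at h2
      rw [smul_apply_atom hw, smul_apply_atom hw, hψ, resolventVector_apply, mul_one_div,
        eq_div_iff (sub_ne_zero.2 (hz n))]
      linear_combination h2
    have h2 := congrArg (fun g => inner ℂ (canonicalPlus hΓ) g) h1
    simp only [inner_smul_right] at h2
    rw [← hqdef, show inner ℂ (canonicalPlus hΓ) f = c * K by rw [hc, div_mul_cancel₀ _ hK]] at h2
    have h3 : c = 0 := by
      refine (mul_eq_zero.1 (?_ : c * (2 * Complex.I * K + (Complex.I + z) * (α - 1) * q)
        = 0)).resolve_right hD
      linear_combination h2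
    rw [h3, mul_zero, neg_zero, zero_smul, smul_eq_zero] at h1
    exact h1.resolve_left (by simp)
  · intro g
    set B := resolventMul hw hacc z g with hB
    set b : ℂ := inner ℂ (canonicalPlus hΓ) B with hb
    set D := 2 * Complex.I * K + (Complex.I + z) * (α - 1) * q with hDdef
    -- The only value of c consistent with pairing the candidate preimage with φ₊.
    set c : ℂ := b / D with hc
    refine ⟨(2 * Complex.I)⁻¹ • (B + (-((Complex.I + z) * (α - 1) * c)) • ψ),
      Lp_atomicMeasure_ext hw fun n => ?_⟩
    have h1 : inner ℂ (canonicalPlus hΓ)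
        ((2 * Complex.I)⁻¹ • (B + (-((Complex.I + z) * (α - 1) * c)) • ψ)) / K = c := by
      rw [inner_smul_right, inner_add_right, inner_smul_right, ← hb, ← hqdef, div_eq_iff hK,
        inv_mul_eq_iff_eq_mul₀ (by simp)]
      have : b = c * D := by rw [hc, div_mul_cancel₀ _ hD]
      rw [this, hDdef]
      ring
    rw [characteristicOperator_apply hw, h1, smul_apply_atom hw, add_apply_atom hw,
      smul_apply_atom hw, hB, hψ, resolventVector_apply, resolventMul_apply]
    have e1 := ofReal_add_I_ne_zero (t n)
    have e2 := sub_ne_zero.2 (hz n)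
    have e3 := Complex.I_ne_zero
    field_simp
    ring

/-- When the determinant vanishes, 1/(x - z) is a kernel vector. -/
theorem exists_characteristicOperator_eq_zero {α z : ℂ} (hz : ∀ n, (t n : ℂ) ≠ z)
    (hΔ : (1 - α) * nevanlinna (atomicMeasure t w) z =
      Complex.I * (1 + α) * (‖canonicalPlus hΓ‖ : ℂ) ^ 2) :
    ∃ f ≠ 0, characteristicOperator hΓ α z f = 0 := by
  have hK := norm_canonicalPlus_sq_ne_zero hΓ (atomicMeasure_ne_zero hw)
  have hq := (integrable_nevanlinna hw hacc hΓ hz).2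
  refine ⟨resolventVector hw hacc hΓ z, fun h => ?_, Lp_atomicMeasure_ext hw fun n => ?_⟩
  · have h1 := resolventVector_apply hw hacc hΓ z (Classical.arbitrary ι)
    rw [h, zero_apply_atom hw] at h1
    exact one_div_ne_zero (sub_ne_zero.2 (hz _)) h1.symm
  · rw [characteristicOperator_apply hw, zero_apply_atom hw, resolventVector_apply, div_eq_zero_iff]
    left
    have e2 := sub_ne_zero.2 (hz n)
    generalize (‖canonicalPlus hΓ‖ : ℂ) ^ 2 = K at *
    have e3 : ∀ a b : ℂ, K * (a * (b / K)) = a * b := fun a b => by field_simp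
    rw [mul_one_div, mul_div_cancel_right₀ _ e2, ← mul_right_inj' hK, mul_zero, mul_add, e3]
    linear_combination (α - 1) * hq - hΔ

variable (ht : Function.Injective t)
include ht

omit hacc [Nonempty ι] in
-- For α = 1 the perturbation disappears and the indicator of the atom is an eigenvector.
theorem exists_characteristicOperator_one_eq_zero (k : ι) :
    ∃ f ≠ 0, characteristicOperator hΓ 1 (t k) f = 0 := by
  set e := indicatorConstLp (μ := atomicMeasure t w) 2 (measurableSet_singleton (t k))
    (atomicMeasure_singleton_ne_top _ ht) (1 : ℂ) with he
  have he' : ∀ n, e (t n) = ({t k} : Set ℝ).indicator (fun _ => (1 : ℂ)) (t n) := fun n =>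
    (ae_atomicMeasure_iff hw).1 (indicatorConstLp_coeFn (p := 2)
      (hs := measurableSet_singleton (t k)) (hμs := atomicMeasure_singleton_ne_top _ ht)
      (c := (1 : ℂ))) n
  refine ⟨e, fun h => ?_, Lp_atomicMeasure_ext hw fun n => ?_⟩
  · have h1 := he' k
    rw [h, zero_apply_atom hw] at h1
    simp at h1
  · rw [characteristicOperator_apply hw, zero_apply_atom hw, he' n]
    by_cases h : n = k
    · simp [h]
    · simp [ht.eq_iff, h]

/-- At z = t_k the k-th coordinate no longer involves f(t_k), so it determines the scalar ⟨φ₊, f⟩/K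
because α ≠ 1. The other coordinates then fix f off t_k, and f(t_k) is recovered from that scalar
since ⟨φ₊, e⟩ ≠ 0. -/
theorem characteristicOperator_bijective_of_eq {α : ℂ} (hα : α ≠ 1) (k : ι) :
    Function.Bijective (characteristicOperator hΓ α (t k)) := by
  have hK := norm_canonicalPlus_sq_ne_zero hΓ (atomicMeasure_ne_zero hw)
  set K : ℂ := (‖canonicalPlus hΓ‖ : ℂ) ^ 2 with hKdef
  have hα' := sub_ne_zero.2 hα
  have hk : Complex.I + (t k : ℂ) ≠ 0 := by rw [add_comm]; exact ofReal_add_I_ne_zero _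
  set e := indicatorConstLp (μ := atomicMeasure t w) 2 (measurableSet_singleton (t k))
    (atomicMeasure_singleton_ne_top _ ht) (1 : ℂ) with he
  have he' : ∀ n, e (t n) = ({t k} : Set ℝ).indicator (fun _ => (1 : ℂ)) (t n) := fun n =>
    (ae_atomicMeasure_iff hw).1 (indicatorConstLp_coeFn (p := 2)
      (hs := measurableSet_singleton (t k)) (hμs := atomicMeasure_singleton_ne_top _ ht)
      (c := (1 : ℂ))) n
  have hek : e (t k) = 1 := by rw [he' k]; simp
  have hen : ∀ n, n ≠ k → e (t n) = 0 := fun n hn => by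
    rw [he' n]
    simp [ht.eq_iff, hn]
  have hinner : inner ℂ (canonicalPlus hΓ) e ≠ 0 := by
    have h1 : inner ℂ (canonicalPlus hΓ) e = (w k : ℂ) / ((t k : ℂ) + Complex.I) := by
      rw [inner_canonicalPlus]
      have h2 : (fun x : ℝ => e x / ((x : ℂ) + Complex.I)) =ᵐ[atomicMeasure t w]
          ({t k} : Set ℝ).indicator fun x : ℝ => 1 / ((x : ℂ) + Complex.I) := by
        refine (ae_atomicMeasure_iff hw).2 fun n => ?_
        by_cases h : n = k
        · simp [h, hek]
        · simp [hen n h, ht.eq_iff, h]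
      rw [integral_congr_ae h2, integral_indicator (measurableSet_singleton _), integral_singleton,
        atomicMeasure_real_singleton hw ht, Complex.real_smul, mul_one_div]
    rw [h1]
    exact div_ne_zero (by exact_mod_cast (hw k).ne') (ofReal_add_I_ne_zero _)
  constructor
  · refine (injective_iff_map_eq_zero _).2 fun f hf => ?_
    set c : ℂ := inner ℂ (canonicalPlus hΓ) f / K with hc
    have h1 : ∀ n, 2 * Complex.I * ((t n : ℂ) - t k) * f (t n) +
        (Complex.I + t k) * (α - 1) * c = 0 := fun n => by
      have h2 := characteristicOperator_apply hw hΓ α (t k) f n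
      rwa [hf, zero_apply_atom hw, eq_comm, div_eq_zero_iff, or_iff_left (ofReal_add_I_ne_zero _),
        ← hc] at h2
    have hc0 : c = 0 := by
      have h2 := h1 k
      rw [sub_self, mul_zero, zero_mul, zero_add] at h2
      exact (mul_eq_zero.1 h2).resolve_left (mul_ne_zero hk hα')
    have hfe : f = f (t k) • e := by
      refine Lp_atomicMeasure_ext hw fun n => ?_
      rw [smul_apply_atom hw]
      by_cases h : n = k
      · rw [h, hek, mul_one]
      · have h2 := h1 n
        rw [hc0, mul_zero, add_zero, mul_eq_zero] at h2
        rw [hen n h, mul_zero]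
        refine h2.resolve_left (mul_ne_zero (by simp) (sub_ne_zero.2 ?_))
        exact_mod_cast fun h3 => h (ht h3)
    have h3 : inner ℂ (canonicalPlus hΓ) f = 0 := by
      rw [hc, div_eq_zero_iff] at hc0
      exact hc0.resolve_right hK
    rw [hfe, inner_smul_right] at h3
    rw [hfe, (mul_eq_zero.1 h3).resolve_right hinner, zero_smul]
  · intro g
    set f₀ := (2 * Complex.I)⁻¹ • (resolventMul hw hacc (t k) g +
      (-((Complex.I + t k) * g (t k))) • resolventVector hw hacc hΓ (t k)) with hf₀
    set c : ℂ := (t k + Complex.I) * g (t k) / ((Complex.I + t k) * (α - 1)) with hc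
    -- The multiple of e that adjusts ⟨φ₊, f₀ + y e⟩ to cK.
    set y : ℂ := (c * K - inner ℂ (canonicalPlus hΓ) f₀) / inner ℂ (canonicalPlus hΓ) e with hy
    refine ⟨f₀ + y • e, Lp_atomicMeasure_ext hw fun n => ?_⟩
    have h1 : inner ℂ (canonicalPlus hΓ) (f₀ + y • e) / K = c := by
      rw [inner_add_right, inner_smul_right (canonicalPlus hΓ) e y, hy, div_mul_cancel₀ _ hinner,
        div_eq_iff hK]
      ring
    have e1 := ofReal_add_I_ne_zero (t n)
    rw [characteristicOperator_apply hw, h1, div_eq_iff e1, hc,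
      mul_div_cancel₀ _ (mul_ne_zero hk hα')]
    by_cases h : n = k
    · rw [h]
      ring
    · have e2 : (t n : ℂ) - t k ≠ 0 := sub_ne_zero.2 (by exact_mod_cast fun h3 => h (ht h3))
      rw [add_apply_atom hw f₀, smul_apply_atom hw y, hen n h, hf₀, smul_apply_atom hw,
        add_apply_atom hw, smul_apply_atom hw, resolventVector_apply, resolventMul_apply]
      field_simp
      ring

end Spectrum

/-- With e = exp(iπθ), 1 - e² = -2ie sin πθ and 1 + e² = 2e cos πθ; the common factor 2ie cancels.
-/
theorem one_sub_exp_mul_eq_iff (θ : ℝ) (M K : ℂ) :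
    (1 - Complex.exp (2 * Real.pi * Complex.I * θ)) * M =
        Complex.I * (1 + Complex.exp (2 * Real.pi * Complex.I * θ)) * K ↔
      M * (Real.sin (Real.pi * θ) : ℂ) = -K * (Real.cos (Real.pi * θ) : ℂ) := by
  set e := Complex.exp ((Real.pi * θ : ℝ) * Complex.I) with he
  have h1 : Complex.exp (2 * Real.pi * Complex.I * θ) = e ^ 2 := by
    rw [he, ← Complex.exp_nat_mul]
    congr 1
    push_cast
    ring
  have h2 : e = (Real.cos (Real.pi * θ) : ℂ) + (Real.sin (Real.pi * θ) : ℂ) * Complex.I := by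
    rw [he, Complex.exp_mul_I, ← Complex.ofReal_cos, ← Complex.ofReal_sin]
  have h3 : (Real.sin (Real.pi * θ) : ℂ) ^ 2 + (Real.cos (Real.pi * θ) : ℂ) ^ 2 = 1 := by
    exact_mod_cast Real.sin_sq_add_cos_sq (Real.pi * θ)
  have h0 : 2 * Complex.I * e ≠ 0 := by simp [he]
  rw [h1, ← mul_right_inj' h0 (b := M * _)]
  generalize (Real.sin (Real.pi * θ) : ℂ) = s at *
  generalize (Real.cos (Real.pi * θ) : ℂ) = c at *
  have e1 : 1 - e ^ 2 = -(2 * Complex.I * e) * s := by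
    rw [h2]
    linear_combination -h3 + s ^ 2 * Complex.I_sq
  have e2 : 1 + e ^ 2 = 2 * e * c := by
    rw [h2]
    linear_combination -h3 + s ^ 2 * Complex.I_sq
  rw [e1, e2]
  constructor <;> intro h <;> linear_combination -h

theorem exp_two_pi_ne_one {θ : ℝ} (h0 : 0 < θ) (h1 : θ < 1) :
    Complex.exp (2 * Real.pi * Complex.I * θ) ≠ 1 := by
  intro h
  have h2 := (one_sub_exp_mul_eq_iff θ 1 0).1 (by rw [h]; simp)
  have h3 : Real.sin (Real.pi * θ) = 0 := by
    rw [one_mul, neg_zero, zero_mul] at h2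
    exact_mod_cast h2
  exact (Real.sin_pos_of_pos_of_lt_pi (mul_pos Real.pi_pos h0)
    (by nlinarith [Real.pi_pos])).ne' h3

/-- The real Nevanlinna function `m(y) = ∫ (1 / (x - y) - x / (1 + x²)) dΓ(x)`. -/
def realNevanlinna (Γ : Measure ℝ) (y : ℝ) : ℝ :=
  ∫ x : ℝ, (1 / (x - y) - x / (1 + x ^ 2)) ∂Γ

theorem nevanlinna_ofReal (Γ : Measure ℝ) (y : ℝ) : nevanlinna Γ y = realNevanlinna Γ y := by
  rw [nevanlinna, realNevanlinna, ← integral_complex_ofReal]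
  push_cast
  rfl

/-! ### Reality of the spectrum and the equation m sin πθ = -K cos πθ -/

section RealSpectrum

variable {ι : Type*} [Countable ι] [Nonempty ι] {t w : ι → ℝ} (hw : ∀ n, 0 < w n)
  (hacc : ∀ p : ℝ, ¬ AccPt p (𝓟 (range t))) (hΓ : IsHerglotz (atomicMeasure t w))
include hw hacc

theorem mem_graphSpectrum_iff_of_ne {z : ℂ} (hz : ∀ n, (t n : ℂ) ≠ z) (θ : ℝ) :
    z ∈ graphSpectrum (extensionGraph (herglotzOperator hΓ) (canonicalPlus hΓ)
      (canonicalMinus hΓ) θ) ↔ nevanlinna (atomicMeasure t w) z * (Real.sin (Real.pi * θ) : ℂ) =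
        -(‖canonicalPlus hΓ‖ : ℂ) ^ 2 * (Real.cos (Real.pi * θ) : ℂ) := by
  rw [← one_sub_exp_mul_eq_iff]
  constructor
  · intro h
    by_contra hne
    exact notMem_graphSpectrum_of_bijective hΓ (atomicMeasure_ne_zero hw)
      (characteristicOperator_bijective_of_ne hw hacc hΓ hz hne) h
  · intro h
    obtain ⟨f, hf, hf'⟩ := exists_characteristicOperator_eq_zero hw hacc hΓ hz h
    exact mem_graphSpectrum_of_apply_eq_zero hΓ (atomicMeasure_ne_zero hw) hf hf'

theorem atom_mem_graphSpectrum_iff (ht : Function.Injective t) (k : ι) {θ : ℝ} (h0 : 0 ≤ θ)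
    (h1 : θ < 1) : (t k : ℂ) ∈ graphSpectrum (extensionGraph (herglotzOperator hΓ)
      (canonicalPlus hΓ) (canonicalMinus hΓ) θ) ↔ θ = 0 := by
  constructor
  · intro h
    by_contra hne
    exact notMem_graphSpectrum_of_bijective hΓ (atomicMeasure_ne_zero hw)
      (characteristicOperator_bijective_of_eq hw hacc hΓ ht
        (exp_two_pi_ne_one (lt_of_le_of_ne h0 (Ne.symm hne)) h1) k) h
  · rintro rfl
    obtain ⟨f, hf, hf'⟩ := exists_characteristicOperator_one_eq_zero hw hΓ ht k
    exact mem_graphSpectrum_of_apply_eq_zero hΓ (atomicMeasure_ne_zero hw) hf (by simpa using hf')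

/-- Im m(z) = Im z · ∫ |x - z|⁻² dΓ(x), and the integral is positive. -/
theorem nevanlinna_im_ne_zero (hΓ : IsHerglotz (atomicMeasure t w)) {z : ℂ} (hz : z.im ≠ 0) :
    (nevanlinna (atomicMeasure t w) z).im ≠ 0 := by
  have hne : ∀ x : ℝ, (x : ℂ) - z ≠ 0 := fun x h => hz (by
    have := congrArg Complex.im h
    simpa using this)
  have hint := (integrable_nevanlinna hw hacc hΓ (z := z) fun n => sub_ne_zero.1 (hne _)).1
  have hpt : ∀ x : ℝ, (1 / ((x : ℂ) - z) - (x : ℂ) / (1 + (x : ℂ) ^ 2)).im =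
      z.im * (Complex.normSq ((x : ℂ) - z))⁻¹ := fun x => by
    have h1 : ((x : ℂ) / (1 + (x : ℂ) ^ 2)).im = 0 := by
      have : (x : ℂ) / (1 + (x : ℂ) ^ 2) = ((x / (1 + x ^ 2) : ℝ) : ℂ) := by push_cast; rfl
      rw [this, Complex.ofReal_im]
    rw [Complex.sub_im, h1, one_div, Complex.inv_im]
    simp [div_eq_mul_inv]
  have him : Integrable (fun x : ℝ => z.im * (Complex.normSq ((x : ℂ) - z))⁻¹)
      (atomicMeasure t w) := hint.im.congr (Eventually.of_forall hpt)
  have hpos : Integrable (fun x : ℝ => (Complex.normSq ((x : ℂ) - z))⁻¹) (atomicMeasure t w) := by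
    refine (him.const_mul z.im⁻¹).congr (Eventually.of_forall fun x => ?_)
    exact inv_mul_cancel_left₀ hz _
  have h : (nevanlinna (atomicMeasure t w) z).im =
      z.im * ∫ x : ℝ, (Complex.normSq ((x : ℂ) - z))⁻¹ ∂atomicMeasure t w := by
    rw [← integral_const_mul, nevanlinna]
    exact (integral_im hint).symm.trans (integral_congr_ae (Eventually.of_forall hpt))
  rw [h]
  refine mul_ne_zero hz fun h0 => ?_
  rw [integral_eq_zero_iff_of_nonneg (fun x => inv_nonneg.2 (Complex.normSq_nonneg _)) hpos] at h0
  have h2 := (ae_atomicMeasure_iff hw).1 h0 (Classical.arbitrary ι)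
  simp only [Pi.zero_apply, inv_eq_zero, map_eq_zero] at h2
  exact hne _ h2

theorem im_eq_zero_of_mem_graphSpectrum {z : ℂ} {θ : ℝ}
    (h : z ∈ graphSpectrum (extensionGraph (herglotzOperator hΓ) (canonicalPlus hΓ)
      (canonicalMinus hΓ) θ)) : z.im = 0 := by
  by_contra hz
  rw [mem_graphSpectrum_iff_of_ne hw hacc hΓ fun n h => hz (by rw [← h, Complex.ofReal_im])] at h
  have hK := norm_canonicalPlus_sq_ne_zero hΓ (atomicMeasure_ne_zero hw)
  -- The right side is real and Im m(z) ≠ 0, so sin πθ = 0; the equation then gives cos πθ = 0 as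
  -- well.
  have h1 := congrArg Complex.im h
  rw [Complex.im_mul_ofReal, ← Complex.ofReal_pow, ← Complex.ofReal_neg, ← Complex.ofReal_mul,
    Complex.ofReal_im, mul_eq_zero,
    or_iff_right (nevanlinna_im_ne_zero hw hacc hΓ hz)] at h1
  rw [h1, Complex.ofReal_zero, mul_zero, eq_comm, mul_eq_zero, neg_eq_zero, or_iff_right hK,
    Complex.ofReal_eq_zero] at h
  have := Real.sin_sq_add_cos_sq (Real.pi * θ)
  rw [h1, h] at this
  norm_num at this

theorem ofReal_mem_graphSpectrum_iff_of_ne {y : ℝ} (hy : y ∉ range t) (θ : ℝ) :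
    (y : ℂ) ∈ graphSpectrum (extensionGraph (herglotzOperator hΓ) (canonicalPlus hΓ)
      (canonicalMinus hΓ) θ) ↔ realNevanlinna (atomicMeasure t w) y * Real.sin (Real.pi * θ) =
        -‖canonicalPlus hΓ‖ ^ 2 * Real.cos (Real.pi * θ) := by
  rw [mem_graphSpectrum_iff_of_ne hw hacc hΓ fun n h => hy ⟨n, by exact_mod_cast h⟩,
    nevanlinna_ofReal]
  norm_cast

omit [Nonempty ι] in
theorem integrable_realNevanlinna (hΓ : IsHerglotz (atomicMeasure t w)) {y : ℝ}
    (hy : y ∉ range t) :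
    Integrable (fun x : ℝ => 1 / (x - y) - x / (1 + x ^ 2)) (atomicMeasure t w) := by
  have h := (integrable_nevanlinna hw hacc hΓ (z := y)
    fun n h => hy ⟨n, by exact_mod_cast h⟩).1.re
  refine h.congr (Eventually.of_forall fun x => ?_)
  have : 1 / ((x : ℂ) - y) - (x : ℂ) / (1 + (x : ℂ) ^ 2) =
      ((1 / (x - y) - x / (1 + x ^ 2) : ℝ) : ℂ) := by push_cast; rfl
  simp only [this]
  exact Complex.ofReal_re _

end RealSpectrum

end

/-! ### The real Nevanlinna function of an atomic measure -/

noncomputable section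

section RealNevanlinna

variable {ι : Type*} [Countable ι] {t w : ι → ℝ} (hw : ∀ n, 0 < w n)
  (hacc : ∀ p : ℝ, ¬ AccPt p (𝓟 (range t))) (hΓ : IsHerglotz (atomicMeasure t w))

/-- The integrand equals (1 + xy)/((x - y)(1 + x²)), and 1 + xy = 1 + y(x - y) + y². The bound is
uniform in y and serves as the dominating function for continuity. -/
theorem abs_one_div_sub_sub_le {x y R d : ℝ} (hR : |y| ≤ R) (hd : 0 < d) (hxy : d ≤ |x - y|) :
    |1 / (x - y) - x / (1 + x ^ 2)| ≤ (R + (1 + R ^ 2) / d) * (1 / (1 + x ^ 2)) := by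
  have hpos : 0 < |x - y| := hd.trans_le hxy
  have hne : x - y ≠ 0 := abs_pos.1 hpos
  have hx : (0 : ℝ) < 1 + x ^ 2 := by positivity
  have h1 : 1 / (x - y) - x / (1 + x ^ 2) = (1 + y * (x - y) + y ^ 2) / (x - y) *
      (1 / (1 + x ^ 2)) := by
    field_simp
    ring
  rw [h1, abs_mul, abs_of_pos (one_div_pos.2 hx)]
  refine mul_le_mul_of_nonneg_right ?_ (one_div_pos.2 hx).le
  rw [abs_div, div_le_iff₀ hpos]
  have hR0 : 0 ≤ R := (abs_nonneg y).trans hR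
  have h2 : |1 + y * (x - y) + y ^ 2| ≤ 1 + R * |x - y| + R ^ 2 := by
    refine (abs_add_three _ _ _).trans ?_
    rw [abs_one, abs_mul, abs_pow]
    gcongr
  have h3 : 1 + R ^ 2 ≤ (1 + R ^ 2) / d * |x - y| := by
    rw [div_mul_eq_mul_div, le_div_iff₀ hd]
    gcongr
  linarith

include hw hacc hΓ

theorem continuousAt_setIntegral_compl_singleton (x₀ : ℝ) :
    ContinuousAt (fun y : ℝ => ∫ x in {x₀}ᶜ, (1 / (x - y) - x / (1 + x ^ 2)) ∂atomicMeasure t w)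
      x₀ := by
  obtain ⟨δ, hδ, h⟩ := exists_pos_le_dist_of_not_accPt (hacc x₀)
  have hball : ∀ᶠ y in 𝓝 x₀, |y - x₀| < δ / 2 := by
    have := Metric.ball_mem_nhds x₀ (half_pos hδ)
    filter_upwards [this] with y hy
    rwa [Metric.mem_ball, Real.dist_eq] at hy
  have hae : ∀ᵐ x ∂(atomicMeasure t w).restrict {x₀}ᶜ, δ ≤ |x - x₀| := by
    rw [ae_restrict_iff' (measurableSet_singleton _).compl, ae_atomicMeasure_iff hw]
    exact fun n hn => h _ ⟨n, rfl⟩ hn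
  refine continuousAt_of_dominated (bound := fun x =>
    ((|x₀| + δ) + (1 + (|x₀| + δ) ^ 2) / (δ / 2)) * (1 / (1 + x ^ 2))) ?_ ?_ ?_ ?_
  · refine Eventually.of_forall fun y => Measurable.aestronglyMeasurable ?_
    fun_prop
  · filter_upwards [hball] with y hy
    filter_upwards [hae] with x hx
    rw [Real.norm_eq_abs]
    refine abs_one_div_sub_sub_le ?_ (half_pos hδ) ?_
    · have := abs_sub_abs_le_abs_sub y x₀
      linarith
    · have := abs_sub_le x y x₀
      linarith
  · exact (hΓ.integrable_one_div.const_mul _).restrict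
  · filter_upwards [hae] with x hx
    have hne : x - x₀ ≠ 0 := abs_pos.1 (hδ.trans_le hx)
    exact (continuousAt_const.div (by fun_prop) hne).sub continuousAt_const

theorem realNevanlinna_eq_add {y : ℝ} (hy : y ∉ range t) (x₀ : ℝ) :
    realNevanlinna (atomicMeasure t w) y = (atomicMeasure t w).real {x₀} *
      (1 / (x₀ - y) - x₀ / (1 + x₀ ^ 2)) +
        ∫ x in {x₀}ᶜ, (1 / (x - y) - x / (1 + x ^ 2)) ∂atomicMeasure t w := by
  rw [realNevanlinna, ← integral_add_compl (measurableSet_singleton x₀)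
    (integrable_realNevanlinna hw hacc hΓ hy), integral_singleton, smul_eq_mul]

omit [Countable ι] hw hΓ in
theorem eventually_notMem_range (x₀ : ℝ) : ∀ᶠ y in 𝓝[≠] x₀, y ∉ range t := by
  have := hacc x₀
  rwa [accPt_iff_frequently_nhdsNE, not_frequently] at this

theorem continuousAt_realNevanlinna {x₀ : ℝ} (hx₀ : x₀ ∉ range t) :
    ContinuousAt (realNevanlinna (atomicMeasure t w)) x₀ := by
  refine (continuousAt_setIntegral_compl_singleton hw hacc hΓ x₀).congr ?_
  have h : ∀ᶠ y in 𝓝 x₀, y ∉ range t := by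
    filter_upwards [eventually_nhdsWithin_iff.1 (eventually_notMem_range hacc x₀)] with y hy
    by_cases hyx : y = x₀
    · rwa [hyx]
    · exact hy hyx
  filter_upwards [h] with y hy
  rw [realNevanlinna_eq_add hw hacc hΓ hy x₀, measureReal_def,
    atomicMeasure_singleton_eq_zero hw hx₀]
  simp

/-- Splitting off the atom at t_n isolates the pole; the rest of the integral is continuous because
the atoms are isolated. -/
theorem exists_realNevanlinna_eq_add_div (ht : Function.Injective t) (n : ι) :
    ∃ r : ℝ → ℝ, ContinuousAt r (t n) ∧ ∀ᶠ y in 𝓝[≠] t n,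
      realNevanlinna (atomicMeasure t w) y = r y + w n / (t n - y) := by
  refine ⟨_, (continuousAt_setIntegral_compl_singleton hw hacc hΓ (t n)).sub
    (continuousAt_const (y := w n * (t n / (1 + t n ^ 2)))), ?_⟩
  filter_upwards [eventually_notMem_range hacc (t n)] with y hy
  rw [realNevanlinna_eq_add hw hacc hΓ hy (t n), atomicMeasure_real_singleton hw ht]
  simp only [Pi.sub_apply]
  ring

/-- With no atom in [x, y], each integrand value 1/(t_n - ·) increases strictly; equal integrals
would force equality at every atom. -/
theorem realNevanlinna_lt [Nonempty ι] {x y : ℝ} (hxy : x < y) (h : ∀ n, t n < x ∨ y < t n) :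
    realNevanlinna (atomicMeasure t w) x < realNevanlinna (atomicMeasure t w) y := by
  have hx := integrable_realNevanlinna hw hacc hΓ (y := x) (by
    rintro ⟨n, rfl⟩
    rcases h n with h | h <;> linarith)
  have hy := integrable_realNevanlinna hw hacc hΓ (y := y) (by
    rintro ⟨n, rfl⟩
    rcases h n with h | h <;> linarith)
  have hlt : ∀ n, 1 / (t n - x) - t n / (1 + t n ^ 2) < 1 / (t n - y) - t n / (1 + t n ^ 2) := by
    intro n
    have : 1 / (t n - x) < 1 / (t n - y) := by
      rcases h n with h | h
      · exact one_div_lt_one_div_of_neg_of_lt (by linarith) (by linarith)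
      · exact one_div_lt_one_div_of_lt (by linarith) (by linarith)
    linarith
  have hle : ∀ᵐ z ∂atomicMeasure t w, 1 / (z - x) - z / (1 + z ^ 2) ≤
    1 / (z - y) - z / (1 + z ^ 2) := (ae_atomicMeasure_iff hw).2 fun n => (hlt n).le
  refine lt_of_le_of_ne (integral_mono_ae hx hy hle) fun heq => ?_
  rw [realNevanlinna, realNevanlinna, integral_eq_iff_of_ae_le hx hy hle] at heq
  exact (hlt (Classical.arbitrary ι)).ne ((ae_atomicMeasure_iff hw).1 heq _)

end RealNevanlinna

/-! ### Indices of gaps -/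

/-- `n` is the index of the half-open gap `[t n, t (n + 1))` that contains `x`; the two unbounded
gaps are included. -/
structure IsGapIndex {F : Set ℤ} (t : F → ℝ) (x : ℝ) (n : ℤ) : Prop where
  le_iff : ∀ k : F, (k : ℤ) ≤ n ↔ t k ≤ x
  mem_or : n ∈ F ∨ n + 1 ∈ F

section Gap

variable {F : Set ℤ} {t : F → ℝ}

theorem IsGapIndex.mono (hF : F.OrdConnected) {x y : ℝ} {a b : ℤ} (ha : IsGapIndex t x a)
    (hb : IsGapIndex t y b) (hxy : x ≤ y) : a ≤ b := by
  by_contra! hlt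
  by_cases haF : a ∈ F
  · have h1 := (ha.le_iff ⟨a, haF⟩).1 le_rfl
    have h2 := (hb.le_iff ⟨a, haF⟩).2 (h1.trans hxy)
    exact absurd h2 (not_le.2 hlt)
  -- Here a is the index just below the first element of F, and b < a would place a between two
  -- elements of F.
  · have ha' := ha.mem_or.resolve_left haF
    rcases hb.mem_or with hbF | hbF
    · exact haF (hF.out hbF ha' ⟨hlt.le, by omega⟩)
    · exact haF (hF.out hbF ha' ⟨by omega, by omega⟩)

theorem IsGapIndex.unique (hF : F.OrdConnected) {x : ℝ} {a b : ℤ} (ha : IsGapIndex t x a)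
    (hb : IsGapIndex t x b) : a = b :=
  le_antisymm (ha.mono hF hb le_rfl) (hb.mono hF ha le_rfl)

theorem finite_preimage_Icc (hacc : ∀ p : ℝ, ¬ AccPt p (𝓟 (range t))) (ht : Function.Injective t)
    (a b : ℝ) : (t ⁻¹' Icc a b).Finite := by
  by_contra h
  have h1 : (t '' (t ⁻¹' Icc a b)).Infinite := Set.Infinite.image ht.injOn h
  obtain ⟨p, -, hp⟩ := h1.exists_accPt_of_subset_isCompact isCompact_Icc (image_preimage_subset _ _)
  exact hacc p (hp.mono (principal_mono.2 (image_subset_range _ _)))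

theorem isGapIndex_self (ht : StrictMono t) (k : F) : IsGapIndex t (t k) k :=
  ⟨fun j => by rw [ht.le_iff_le, Subtype.coe_le_coe], Or.inl k.2⟩

theorem exists_isGapIndex [Nonempty F] (hacc : ∀ p : ℝ, ¬ AccPt p (𝓟 (range t)))
    (ht : StrictMono t) (x : ℝ) : ∃ n, IsGapIndex t x n := by
  by_cases h : ∃ k, t k ≤ x
  · obtain ⟨k₀, hk₀⟩ := h
    obtain ⟨k₁, hk₁, hmax⟩ := exists_max_image _ id
      (finite_preimage_Icc hacc ht.injective (t k₀) x) ⟨k₀, le_rfl, hk₀⟩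
    refine ⟨k₁, fun k => ⟨fun hk => (ht.monotone hk).trans hk₁.2, fun hk => ?_⟩, Or.inl k₁.2⟩
    rcases le_total k₀ k with hle | hle
    · exact hmax k ⟨ht.monotone hle, hk⟩
    · exact hle.trans (ht.le_iff_le.1 hk₁.1)
  · push Not at h
    let k₀ : F := Classical.arbitrary F
    obtain ⟨k₁, hk₁, hmin⟩ := exists_min_image _ id
      (finite_preimage_Icc hacc ht.injective x (t k₀)) ⟨k₀, (h k₀).le, le_rfl⟩
    -- Below all atoms the gap carries the index preceding the least element of F, which is not
    -- itself in F.
    refine ⟨k₁ - 1, fun k => ⟨fun hk => ?_, fun hk => absurd hk (not_le.2 (h k))⟩,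
      Or.inr (by simp)⟩
    have hlt : k < k₁ := Subtype.coe_lt_coe.1 (by omega)
    have := hmin k ⟨(h k).le, (ht.monotone hlt.le).trans hk₁.2⟩
    exact absurd this (not_le.2 hlt)

/-- The index of the gap that contains `x`. -/
def gapIndex (t : F → ℝ) (x : ℝ) : ℤ := Classical.epsilon (IsGapIndex t x)

theorem gapIndex_spec [Nonempty F] (hacc : ∀ p : ℝ, ¬ AccPt p (𝓟 (range t)))
    (ht : StrictMono t) (x : ℝ) : IsGapIndex t x (gapIndex t x) :=
  Classical.epsilon_spec (exists_isGapIndex hacc ht x)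

open Classical in
/-- The phase of `m`: it takes the value `n` at `t n`, and increases by one over each bounded gap. -/
def phase (t : F → ℝ) (m : ℝ → ℝ) (K : ℝ) (x : ℝ) : ℝ :=
  if x ∈ range t then gapIndex t x else gapIndex t x + (1 / 2 + Real.arctan (m x / K) / Real.pi)

theorem half_add_arctan_div_pi_mem (a : ℝ) : 1 / 2 + Real.arctan a / Real.pi ∈ Ioo (0 : ℝ) 1 := by
  have h1 := Real.neg_pi_div_two_lt_arctan a
  have h2 := Real.arctan_lt_pi_div_two a
  constructor
  · have : -(1 / 2) < Real.arctan a / Real.pi := by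
      rw [lt_div_iff₀ Real.pi_pos]
      linarith
    linarith
  · have : Real.arctan a / Real.pi < 1 / 2 := by
      rw [div_lt_iff₀ Real.pi_pos]
      linarith
    linarith

/-! ### Monotonicity, continuity and derivative of the phase -/

variable [Nonempty F] (hF : F.OrdConnected) (hacc : ∀ p : ℝ, ¬ AccPt p (𝓟 (range t)))
  (ht : StrictMono t)

omit [Nonempty F] in
theorem phase_of_notMem {x : ℝ} (hx : x ∉ range t) (m : ℝ → ℝ) (K : ℝ) :
    phase t m K x = gapIndex t x + (1 / 2 + Real.arctan (m x / K) / Real.pi) := by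
  rw [phase, if_neg hx]

include hF hacc ht

theorem gapIndex_eq {x : ℝ} {n : ℤ} (h : IsGapIndex t x n) : gapIndex t x = n :=
  (gapIndex_spec hacc ht x).unique hF h

theorem gapIndex_self (k : F) : gapIndex t (t k) = k :=
  gapIndex_eq hF hacc ht (isGapIndex_self ht k)

theorem phase_self (m : ℝ → ℝ) (K : ℝ) (k : F) : phase t m K (t k) = k := by
  rw [phase, if_pos ⟨k, rfl⟩, gapIndex_self hF hacc ht]

omit [Nonempty F] hF hacc ht in
theorem phase_mem_Ico (m : ℝ → ℝ) (K x : ℝ) :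
    phase t m K x ∈ Ico (gapIndex t x : ℝ) (gapIndex t x + 1) := by
  by_cases hx : x ∈ range t
  · rw [phase, if_pos hx]
    simp
  · have h := half_add_arctan_div_pi_mem (m x / K)
    rw [phase_of_notMem hx]
    exact ⟨by linarith [h.1], by linarith [h.2]⟩

/-- Different gaps have phases in disjoint unit intervals. Within one gap no atom lies in (x, y],
and m increases. -/
theorem strictMono_phase {m : ℝ → ℝ} {K : ℝ} (hK : 0 < K)
    (hm : ∀ x y, x < y → (∀ n, t n < x ∨ y < t n) → m x < m y) : StrictMono (phase t m K) := by
  intro x y hxy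
  have hx := gapIndex_spec hacc ht x
  have hy := gapIndex_spec hacc ht y
  have hpx := phase_mem_Ico (t := t) m K x
  have hpy := phase_mem_Ico (t := t) m K y
  rcases (hx.mono hF hy hxy.le).lt_or_eq with hlt | heq
  · have : (gapIndex t x : ℝ) + 1 ≤ gapIndex t y := by exact_mod_cast hlt
    linarith [hpx.2, hpy.1]
  · have hle : ∀ k, t k ≤ y → t k ≤ x := fun k hk =>
      (hx.le_iff k).1 (heq ▸ (hy.le_iff k).2 hk)
    have hyr : y ∉ range t := by
      rintro ⟨k, rfl⟩
      exact absurd (hle k le_rfl) (not_le.2 hxy)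
    rw [phase_of_notMem hyr]
    by_cases hxr : x ∈ range t
    · rw [phase, if_pos hxr, heq]
      linarith [(half_add_arctan_div_pi_mem (m y / K)).1]
    · rw [phase_of_notMem hxr, heq]
      have h1 : m x / K < m y / K := by
        refine div_lt_div_of_pos_right (hm x y hxy fun n => ?_) hK
        by_cases hn : t n ≤ y
        · exact Or.inl (lt_of_le_of_ne (hle n hn) fun h => hxr ⟨n, h⟩)
        · exact Or.inr (not_le.1 hn)
      have h2 := div_lt_div_of_pos_right (Real.arctan_strictMono h1) Real.pi_pos
      linarith

theorem eventually_gapIndex_eq {x₀ : ℝ} (hx₀ : x₀ ∉ range t) :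
    ∀ᶠ y in 𝓝 x₀, gapIndex t y = gapIndex t x₀ ∧ y ∉ range t := by
  obtain ⟨δ, hδ, h⟩ := exists_pos_le_dist_of_not_accPt (hacc x₀)
  filter_upwards [Metric.ball_mem_nhds x₀ hδ] with y hy
  rw [Metric.mem_ball, Real.dist_eq] at hy
  have hspec := gapIndex_spec hacc ht x₀
  have hne : ∀ k, t k ≠ x₀ := fun k hk => hx₀ ⟨k, hk⟩
  constructor
  · refine gapIndex_eq hF hacc ht ⟨fun k => (hspec.le_iff k).trans ?_, hspec.mem_or⟩
    have hk := h (t k) ⟨k, rfl⟩ (hne k)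
    constructor <;> intro hle <;> by_contra! hlt
    · rw [abs_of_nonpos (by linarith)] at hk
      linarith [neg_abs_le (y - x₀)]
    · rw [abs_of_pos (by linarith)] at hk
      linarith [le_abs_self (y - x₀)]
  · rintro ⟨k, rfl⟩
    linarith [h (t k) ⟨k, rfl⟩ (hne k)]

theorem eventually_gapIndex_eq_ite (n : F) :
    ∀ᶠ y in 𝓝[≠] t n, gapIndex t y = (if t n < y then (n : ℤ) else n - 1) ∧ y ∉ range t := by
  obtain ⟨δ, hδ, h⟩ := exists_pos_le_dist_of_not_accPt (hacc (t n))
  rw [eventually_nhdsWithin_iff]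
  filter_upwards [Metric.ball_mem_nhds (t n) hδ] with y hy hyn
  rw [Metric.mem_ball, Real.dist_eq] at hy
  have hk : ∀ k, k ≠ n → δ ≤ |t k - t n| := fun k hk => h _ ⟨k, rfl⟩ fun h => hk (ht.injective h)
  refine ⟨?_, ?_⟩
  · split_ifs with hlt
    · refine gapIndex_eq hF hacc ht ⟨fun k => ?_, Or.inl n.2⟩
      rw [Subtype.coe_le_coe]
      constructor
      · exact fun hle => (ht.monotone hle).trans hlt.le
      · intro hle
        by_contra! hnk
        have h1 := hk k hnk.ne'
        rw [abs_of_pos (sub_pos.2 (ht hnk))] at h1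
        linarith [le_abs_self (y - t n)]
    · have hlt' : y < t n := lt_of_le_of_ne (not_lt.1 hlt) hyn
      refine gapIndex_eq hF hacc ht ⟨fun k => ?_, Or.inr (by simp)⟩
      rw [Int.le_sub_one_iff, Subtype.coe_lt_coe]
      constructor
      · intro hkn
        by_contra! hyk
        have h1 := hk k hkn.ne
        rw [abs_of_neg (sub_neg.2 (ht hkn))] at h1
        linarith [neg_abs_le (y - t n)]
      · exact fun hle => ht.lt_iff_lt.1 (hle.trans_lt hlt')
  · rintro ⟨k, rfl⟩
    have := hk k fun h => hyn (by rw [h]; rfl)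
    linarith

theorem continuousAt_phase {m : ℝ → ℝ} (K : ℝ) {x₀ : ℝ} (hx₀ : x₀ ∉ range t)
    (hm : ContinuousAt m x₀) : ContinuousAt (phase t m K) x₀ := by
  have h : ContinuousAt
      (fun y => (gapIndex t x₀ : ℝ) + (1 / 2 + Real.arctan (m y / K) / Real.pi)) x₀ :=
    continuousAt_const.add (continuousAt_const.add
      ((Real.continuous_arctan.continuousAt.comp (hm.div_const K)).div_const _))
  refine h.congr ?_
  filter_upwards [eventually_gapIndex_eq hF hacc ht hx₀] with y hy
  rw [phase_of_notMem hy.2, hy.1]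

omit [Nonempty F] hF hacc ht in
-- The factor y - a makes continuity of q at a sufficient, so the regular part of m need not be
-- shown differentiable.
theorem hasDerivAt_sub_mul {q : ℝ → ℝ} {a : ℝ} (hq : ContinuousAt q a) :
    HasDerivAt (fun y => (y - a) * q y) (q a) a := by
  rw [hasDerivAt_iff_tendsto_slope]
  refine (hq.tendsto.mono_left nhdsWithin_le_nhds).congr' ?_
  filter_upwards [self_mem_nhdsWithin] with y hy
  have := sub_ne_zero.2 (show y ≠ a from hy)
  rw [slope_def_field]
  field_simp
  ring

/-- The reflection arctan(1/u) = ±π/2 - arctan u, with the sign of u, cancels the jump of the gap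
index from n - 1 to n. One formula thus holds on both sides of the pole and at t_n. -/
theorem eventually_phase_eq {m r : ℝ → ℝ} {K c : ℝ} (hK : 0 < K) (hc : 0 < c) (n : F)
    (hr : ContinuousAt r (t n)) (hm : ∀ᶠ y in 𝓝[≠] t n, m y = r y + c / (t n - y)) :
    ∀ᶠ y in 𝓝 (t n), phase t m K y =
      n + Real.arctan ((y - t n) * (K / (c + r y * (t n - y)))) / Real.pi := by
  have hD : ContinuousAt (fun y => c + r y * (t n - y)) (t n) :=
    continuousAt_const.add (hr.mul (by fun_prop))
  have hpos : ∀ᶠ y in 𝓝 (t n), 0 < c + r y * (t n - y) :=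
    hD.eventually (lt_mem_nhds (by simpa using hc))
  have hboth := (eventually_gapIndex_eq_ite hF hacc ht n).and hm
  rw [eventually_nhdsWithin_iff] at hboth
  filter_upwards [hpos, hboth] with y hDy hy
  by_cases hyn : y = t n
  · rw [hyn, phase_self hF hacc ht]
    simp
  obtain ⟨⟨hgap, hrange⟩, hmy⟩ := hy hyn
  set D := c + r y * (t n - y) with hDdef
  have hne : t n - y ≠ 0 := sub_ne_zero.2 (Ne.symm hyn)
  have hmy' : m y = D / (t n - y) := by
    rw [hmy, hDdef]
    field_simp
    ring
  rw [phase_of_notMem hrange, hgap]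
  have hpi := Real.pi_ne_zero
  split_ifs with hlt
  · have hu : 0 < (y - t n) * (K / D) := mul_pos (sub_pos.2 hlt) (div_pos hK hDy)
    have h1 : m y / K = -((y - t n) * (K / D))⁻¹ := by
      have hne' : y - t n ≠ 0 := (sub_pos.2 hlt).ne'
      rw [hmy', ← neg_sub y (t n)]
      field_simp
    rw [h1, Real.arctan_neg, Real.arctan_inv_of_pos hu]
    field_simp
    ring
  · have hlt' : y < t n := lt_of_le_of_ne (not_lt.1 hlt) hyn
    have hu : 0 < (t n - y) * (K / D) := mul_pos (sub_pos.2 hlt') (div_pos hK hDy)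
    have h1 : m y / K = ((t n - y) * (K / D))⁻¹ := by
      rw [hmy']
      field_simp
    rw [h1, Real.arctan_inv_of_pos hu, ← neg_sub y (t n), neg_mul, Real.arctan_neg]
    push_cast
    field_simp
    ring

theorem hasDerivAt_phase {m r : ℝ → ℝ} {K c : ℝ} (hK : 0 < K) (hc : 0 < c) (n : F)
    (hr : ContinuousAt r (t n)) (hm : ∀ᶠ y in 𝓝[≠] t n, m y = r y + c / (t n - y)) :
    HasDerivAt (phase t m K) (K / c / Real.pi) (t n) := by
  have hD : ContinuousAt (fun y => c + r y * (t n - y)) (t n) :=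
    continuousAt_const.add (hr.mul (by fun_prop))
  have hq : ContinuousAt (fun y => K / (c + r y * (t n - y))) (t n) :=
    continuousAt_const.div hD (by simpa using hc.ne')
  have h1 := ((hasDerivAt_sub_mul hq).arctan.div_const Real.pi).const_add (n : ℝ)
  refine (h1.congr_deriv ?_).congr_of_eventuallyEq
    (eventually_phase_eq hF hacc ht hK hc n hr hm)
  simp

omit [Nonempty F] hF hacc ht in
/-- The points at which the phase is congruent to `θ` modulo one. -/
theorem exists_phase_eq_iff {m : ℝ → ℝ} {K : ℝ} (hK : 0 < K) {x θ : ℝ} (hx : x ∉ range t)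
    (hθ : θ ∈ Ico (0 : ℝ) 1) : (∃ n : ℤ, phase t m K x = n + θ) ↔
      m x * Real.sin (Real.pi * θ) = -K * Real.cos (Real.pi * θ) := by
  have hmem := half_add_arctan_div_pi_mem (m x / K)
  have hpi := Real.pi_pos
  rw [phase_of_notMem hx]
  -- After the shift by π/2 the equation becomes m/K = tan(πθ - π/2), whose argument lies in the
  -- range of arctan for 0 < θ < 1.
  have hsin : Real.sin (Real.pi * θ) = Real.cos (Real.pi * θ - Real.pi / 2) := by
    rw [Real.cos_sub_pi_div_two]
  have hcos : -Real.cos (Real.pi * θ) = Real.sin (Real.pi * θ - Real.pi / 2) := by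
    rw [Real.sin_sub_pi_div_two]
  constructor
  · rintro ⟨n, h⟩
    have h1 : gapIndex t x = n := by
      have h2 : (gapIndex t x : ℝ) < n + 1 := by linarith [hmem.1, hθ.2]
      have h3 : (n : ℝ) < gapIndex t x + 1 := by linarith [hmem.2, hθ.1]
      have h4 : gapIndex t x < n + 1 := by exact_mod_cast h2
      have h5 : n < gapIndex t x + 1 := by exact_mod_cast h3
      omega
    rw [h1, add_right_inj] at h
    have h2 : Real.pi * θ - Real.pi / 2 = Real.arctan (m x / K) := by
      rw [← h]
      field_simp
      ring
    have hc : Real.cos (Real.arctan (m x / K)) ≠ 0 := (Real.cos_arctan_pos _).ne'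
    rw [neg_mul, ← mul_neg, hcos, hsin, h2, ← Real.tan_mul_cos hc, Real.tan_arctan]
    field_simp
  · intro h
    refine ⟨gapIndex t x, ?_⟩
    -- At θ = 0 the equation would read 0 = -K.
    have hθ0 : 0 < θ := by
      refine lt_of_le_of_ne hθ.1 fun h0 => ?_
      rw [← h0] at h
      simp at h
      exact hK.ne' h
    rw [neg_mul, ← mul_neg, hcos, hsin] at h
    have hlo : -(Real.pi / 2) < Real.pi * θ - Real.pi / 2 := by nlinarith
    have hhi : Real.pi * θ - Real.pi / 2 < Real.pi / 2 := by nlinarith [hθ.2]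
    have hc := Real.cos_pos_of_mem_Ioo ⟨hlo, hhi⟩
    have h1 : m x / K = Real.tan (Real.pi * θ - Real.pi / 2) := by
      rw [Real.tan_eq_sin_div_cos, div_eq_div_iff hK.ne' hc.ne', h]
      ring
    rw [h1, Real.arctan_tan hlo hhi]
    field_simp
    ring

end Gap

end

/-! ### The spectral function -/

noncomputable section

theorem IsIndexSet.ordConnected {F : Set ℤ} (hF : IsIndexSet F) : F.OrdConnected := by
  rcases hF with rfl | rfl | rfl | ⟨N, rfl⟩
  · exact ordConnected_Ici
  · exact ordConnected_Iic
  · exact ordConnected_univ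
  · exact ordConnected_Icc

theorem IsIndexSet.nonempty {F : Set ℤ} (hF : IsIndexSet F) : F.Nonempty := by
  rcases hF with rfl | rfl | rfl | ⟨N, rfl⟩ <;> exact ⟨0, by simp⟩

section SpectralFunction

variable {F : Set ℤ} {t w : F → ℝ} (hF : IsIndexSet F) (ht : StrictMono t)
  (hacc : ∀ p : ℝ, ¬ AccPt p (𝓟 (range t))) (hw : ∀ n, 0 < w n)
  (hΓ : IsHerglotz (atomicMeasure t w))

/-- The inverse of the spectral function. -/
def spectralPhase : ℝ → ℝ :=
  phase t (realNevanlinna (atomicMeasure t w)) (‖canonicalPlus hΓ‖ ^ 2)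

include hF ht hacc hw

omit ht hacc in
theorem norm_canonicalPlus_sq_pos : 0 < ‖canonicalPlus hΓ‖ ^ 2 := by
  have : Nonempty F := hF.nonempty.to_subtype
  exact pow_pos (norm_pos_iff.2 (canonicalPlus_ne_zero hΓ (atomicMeasure_ne_zero hw))) 2

omit hw in
theorem spectralPhase_self (n : F) : spectralPhase hΓ (t n) = (n : ℤ) := by
  have : Nonempty F := hF.nonempty.to_subtype
  exact phase_self hF.ordConnected hacc ht _ _ n

theorem ofReal_mem_graphSpectrum_iff {y θ : ℝ} (hθ : θ ∈ Ico (0 : ℝ) 1) :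
    (y : ℂ) ∈ graphSpectrum (extensionGraph (herglotzOperator hΓ) (canonicalPlus hΓ)
      (canonicalMinus hΓ) θ) ↔ ∃ n : ℤ, spectralPhase hΓ y = n + θ := by
  have : Nonempty F := hF.nonempty.to_subtype
  by_cases hy : y ∈ range t
  · obtain ⟨k, rfl⟩ := hy
    rw [atom_mem_graphSpectrum_iff hw hacc hΓ ht.injective k hθ.1 hθ.2,
      spectralPhase_self hF ht hacc]
    constructor
    · rintro rfl
      exact ⟨k, by simp⟩
    · rintro ⟨n, h⟩
      have h1 : ((k : ℤ) : ℝ) < n + 1 := by linarith [hθ.2]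
      have h2 : (n : ℝ) ≤ (k : ℤ) := by linarith [hθ.1]
      have h3 : (k : ℤ) = n := by
        have h4 : (k : ℤ) < n + 1 := by exact_mod_cast h1
        have h5 : n ≤ (k : ℤ) := by exact_mod_cast h2
        omega
      rw [h3] at h
      linarith
  · rw [ofReal_mem_graphSpectrum_iff_of_ne hw hacc hΓ hy, spectralPhase,
      exists_phase_eq_iff (norm_canonicalPlus_sq_pos hF hw hΓ) hy hθ]

theorem strictMono_spectralPhase : StrictMono (spectralPhase hΓ) := by
  have : Nonempty F := hF.nonempty.to_subtype
  exact strictMono_phase hF.ordConnected hacc ht (norm_canonicalPlus_sq_pos hF hw hΓ)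
    fun _ _ hxy h => realNevanlinna_lt hw hacc hΓ hxy h

theorem hasDerivAt_spectralPhase (n : F) :
    HasDerivAt (spectralPhase hΓ) (‖canonicalPlus hΓ‖ ^ 2 / w n / Real.pi) (t n) := by
  have : Nonempty F := hF.nonempty.to_subtype
  obtain ⟨r, hr, hm⟩ := exists_realNevanlinna_eq_add_div hw hacc hΓ ht.injective n
  exact hasDerivAt_phase hF.ordConnected hacc ht (norm_canonicalPlus_sq_pos hF hw hΓ)
    (hw n) n hr hm

theorem continuous_spectralPhase : Continuous (spectralPhase hΓ) := by
  have : Nonempty F := hF.nonempty.to_subtype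
  refine continuous_iff_continuousAt.2 fun x => ?_
  by_cases hx : x ∈ range t
  · obtain ⟨n, rfl⟩ := hx
    exact (hasDerivAt_spectralPhase hF ht hacc hw hΓ n).continuousAt
  · exact continuousAt_phase hF.ordConnected hacc ht _ hx
      (continuousAt_realNevanlinna hw hacc hΓ hx)

theorem intCast_mem_range_spectralPhase_iff (n : ℤ) :
    (n : ℝ) ∈ range (spectralPhase hΓ) ↔ n ∈ F := by
  constructor
  · rintro ⟨x, hx⟩
    by_cases hxr : x ∈ range t
    · obtain ⟨k, rfl⟩ := hxr
      rw [spectralPhase_self hF ht hacc hΓ k] at hx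
      have : (k : ℤ) = n := by exact_mod_cast hx
      exact this ▸ k.2
    · have h := (exists_phase_eq_iff (norm_canonicalPlus_sq_pos hF hw hΓ) hxr
        (θ := 0) (by simp)).1 ⟨n, by rw [add_zero]; exact hx⟩
      simp at h
      exact absurd h (canonicalPlus_ne_zero hΓ
        (by have : Nonempty F := hF.nonempty.to_subtype; exact atomicMeasure_ne_zero hw))
  · exact fun hn => ⟨t ⟨n, hn⟩, spectralPhase_self hF ht hacc hΓ ⟨n, hn⟩⟩

/-- Taking J to be the range of the phase avoids computing its endpoints; surjectivity onto ℝ holds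
because the phase is defined everywhere. -/
theorem isSpectralFunction_invFun :
    IsSpectralFunction (herglotzOperator hΓ) (canonicalPlus hΓ) (canonicalMinus hΓ) t
      (range (spectralPhase hΓ)) (Function.invFun (spectralPhase hΓ)) := by
  have : Nonempty F := hF.nonempty.to_subtype
  have hmono := strictMono_spectralPhase hF ht hacc hw hΓ
  have hinv : ∀ x, Function.invFun (spectralPhase hΓ) (spectralPhase hΓ x) = x :=
    Function.leftInverse_invFun hmono.injective
  refine ⟨isDeficiencyPair_canonical hΓ (atomicMeasure_ne_zero hw),
    (isPreconnected_range (continuous_spectralPhase hF ht hacc hw hΓ)).ordConnected, ?_, ?_,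
    intCast_mem_range_spectralPhase_iff hF ht hacc hw hΓ, fun n => ?_, fun θ hθ => ?_⟩
  · rintro _ ⟨x, rfl⟩ _ ⟨y, rfl⟩ hxy
    rw [hinv, hinv]
    exact hmono.lt_iff_lt.1 hxy
  · exact fun x _ => ⟨_, ⟨x, rfl⟩, hinv x⟩
  · rw [← spectralPhase_self hF ht hacc hΓ n, hinv]
  · ext z
    constructor
    · intro hz
      have him := im_eq_zero_of_mem_graphSpectrum hw hacc hΓ hz
      have hz' : z = (z.re : ℂ) := Complex.ext rfl (by simp [him])
      rw [hz', ofReal_mem_graphSpectrum_iff hF ht hacc hw hΓ hθ] at hz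
      obtain ⟨n, hn⟩ := hz
      refine ⟨n, ⟨z.re, hn⟩, ?_⟩
      rw [← hn, hinv]
      exact hz'
    · rintro ⟨n, ⟨x, hx⟩, rfl⟩
      rw [← hx, hinv, ofReal_mem_graphSpectrum_iff hF ht hacc hw hΓ hθ]
      exact ⟨n, hx⟩

/-! ### Derivatives of an arbitrary spectral function, and normalization -/

variable {hΓ} {J : Set ℝ} {s : ℝ → ℝ}

theorem IsSpectralFunction.hasDerivAt
    (hs : IsSpectralFunction (herglotzOperator hΓ) (canonicalPlus hΓ) (canonicalMinus hΓ) t J s)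
    (n : F) :
    HasDerivAt s (Real.pi * w n / ‖canonicalPlus hΓ‖ ^ 2) ((n : ℤ) : ℝ) := by
  have hK := norm_canonicalPlus_sq_pos hF hw hΓ
  have hnJ : ((n : ℤ) : ℝ) ∈ J := (hs.mem_iff n).2 n.2
  -- Preimages of t_n - 1 and t_n + 1 lie in J on either side of n.
  have hJ : J ∈ 𝓝 ((n : ℤ) : ℝ) := by
    obtain ⟨a, ha, hsa⟩ := hs.surjOn (mem_univ (t n - 1))
    obtain ⟨b, hb, hsb⟩ := hs.surjOn (mem_univ (t n + 1))
    have hsn := hs.apply_index n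
    have han : a < (n : ℤ) := (hs.strictMonoOn.lt_iff_lt ha hnJ).1 (by linarith)
    have hnb : ((n : ℤ) : ℝ) < b := (hs.strictMonoOn.lt_iff_lt hnJ hb).1 (by linarith)
    exact mem_of_superset (Icc_mem_nhds han hnb) (hs.ordConnected.out ha hb)
  have hcont : ContinuousAt s ((n : ℤ) : ℝ) := by
    refine hs.strictMonoOn.continuousAt_of_image_mem_nhds hJ ?_
    rw [univ_subset_iff.1 hs.surjOn]
    exact univ_mem
  -- The spectrum of T_θ with θ = fract q fixes the phase of s(q) only modulo 1.
  have hshift : ∀ q ∈ J, ∃ k : ℤ, spectralPhase hΓ (s q) - q = k := by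
    intro q hq
    have hθ : Int.fract q ∈ Ico (0 : ℝ) 1 := ⟨Int.fract_nonneg q, Int.fract_lt_one q⟩
    have hmem : (s q : ℂ) ∈ graphSpectrum (extensionGraph (herglotzOperator hΓ)
        (canonicalPlus hΓ) (canonicalMinus hΓ) (Int.fract q)) := by
      rw [hs.spectrum_eq _ hθ]
      exact ⟨⌊q⌋, by rwa [Int.floor_add_fract], by rw [Int.floor_add_fract]⟩
    obtain ⟨k, hk⟩ := (ofReal_mem_graphSpectrum_iff hF ht hacc hw hΓ hθ).1 hmem
    refine ⟨k - ⌊q⌋, ?_⟩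
    push_cast
    linarith [Int.floor_add_fract q]
  -- The integer-valued difference is continuous at n and vanishes there, so it is zero nearby.
  have hinv : ∀ᶠ q in 𝓝 ((n : ℤ) : ℝ), spectralPhase hΓ (s q) = q := by
    have h1 : ContinuousAt (fun q => spectralPhase hΓ (s q) - q) ((n : ℤ) : ℝ) :=
      ((continuous_spectralPhase hF ht hacc hw hΓ).continuousAt.comp hcont).sub continuousAt_id
    have h2 : spectralPhase hΓ (s ((n : ℤ) : ℝ)) - ((n : ℤ) : ℝ) = 0 := by
      rw [hs.apply_index, spectralPhase_self hF ht hacc, sub_self]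
    have h3 := h1.eventually (Ioo_mem_nhds (show (-1 : ℝ) < _ from
      (by norm_num : (-1 : ℝ) < 0).trans_eq h2.symm)
      (show _ < (1 : ℝ) from h2.trans_lt one_pos))
    filter_upwards [h3, hJ] with q hq hqJ
    obtain ⟨k, hk⟩ := hshift q hqJ
    rw [hk] at hq
    have h4 : -1 < k := by exact_mod_cast hq.1
    have h5 : k < 1 := by exact_mod_cast hq.2
    have h6 : k = 0 := by omega
    rw [h6, Int.cast_zero, sub_eq_zero] at hk
    exact hk
  have hd := hasDerivAt_spectralPhase hF ht hacc hw hΓ n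
  rw [← hs.apply_index n] at hd
  refine (HasDerivAt.of_local_left_inverse hcont hd ?_ hinv).congr_deriv ?_
  · exact (div_pos (div_pos hK (hw n)) Real.pi_pos).ne'
  · have := hK.ne'
    have := (hw n).ne'
    field_simp

variable (hΓ)

omit hF hacc ht in
theorem hasSum_norm_sq_canonicalPlus :
    HasSum (fun n => w n / (1 + t n ^ 2)) (‖canonicalPlus hΓ‖ ^ 2) := by
  rw [norm_sq_canonicalPlus]
  have h := hasSum_integral_measure (μ := fun n => ENNReal.ofReal (w n) • Measure.dirac (t n))
    hΓ.integrable_one_div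
  have e : (fun n => w n / (1 + t n ^ 2)) = fun n =>
      ∫ x : ℝ, 1 / (1 + x ^ 2) ∂(ENNReal.ofReal (w n) • Measure.dirac (t n)) := by
    funext n
    rw [integral_smul_measure, integral_dirac, ENNReal.toReal_ofReal (hw n).le, smul_eq_mul,
      mul_one_div]
  rw [e]
  exact h

theorem norm_sq_canonicalPlus_eq_one_iff :
    ‖canonicalPlus hΓ‖ ^ 2 = 1 ↔ IsNormalizedBandlimitPair F t (fun n => Real.pi * w n) := by
  have h := (hasSum_norm_sq_canonicalPlus hw hΓ).mul_left Real.pi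
  simp only [← mul_div_assoc] at h
  constructor
  · intro h1
    refine ⟨⟨hF, ht, hacc, fun n => mul_pos Real.pi_pos (hw n), h.summable⟩, ?_⟩
    rw [h.tsum_eq, h1, mul_one]
  · intro hN
    have h1 := h.tsum_eq.symm.trans hN.tsum_eq
    exact mul_left_cancel₀ Real.pi_ne_zero (h1.trans (mul_one _).symm)

end SpectralFunction

end

theorem mainTheorem9 (F : Set ℤ) (hF : IsIndexSet F) (t w : F → ℝ) (ht : StrictMono t)
    (hacc : ∀ p : ℝ, ¬ AccPt p (𝓟 (Set.range t))) (hw : ∀ n, 0 < w n)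
    (hΓ : IsHerglotz (atomicMeasure t w)) :
    (∃ (J : Set ℝ) (s : ℝ → ℝ),
      IsSpectralFunction (herglotzOperator hΓ) (canonicalPlus hΓ) (canonicalMinus hΓ) t J s) ∧
    (∀ (J : Set ℝ) (s : ℝ → ℝ),
      IsSpectralFunction (herglotzOperator hΓ) (canonicalPlus hΓ) (canonicalMinus hΓ) t J s →
      (∀ n : F,
        DifferentiableAt ℝ s ((n : ℤ) : ℝ) ∧
        w n = ‖canonicalPlus hΓ‖ ^ 2 / Real.pi *
          derivWithin (fun θ : ℝ => s (((n : ℤ) : ℝ) + θ)) (Set.Ico 0 1) 0 ∧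
        w n = ‖canonicalPlus hΓ‖ ^ 2 / Real.pi * deriv s ((n : ℤ) : ℝ)) ∧
      (‖canonicalPlus hΓ‖ ^ 2 = 1 → ∀ n : F, deriv s ((n : ℤ) : ℝ) = Real.pi * w n)) ∧
    (‖canonicalPlus hΓ‖ ^ 2 = 1 ↔
      IsNormalizedBandlimitPair F t (fun n => Real.pi * w n)) := by
  refine ⟨⟨_, _, isSpectralFunction_invFun hF ht hacc hw hΓ⟩, fun J s hs => ⟨fun n => ?_,
    fun h n => ?_⟩, norm_sq_canonicalPlus_eq_one_iff hF ht hacc hw hΓ⟩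
  · have hd := hs.hasDerivAt hF ht hacc hw n
    have hK := (norm_canonicalPlus_sq_pos hF hw hΓ).ne'
    have hw' : w n = ‖canonicalPlus hΓ‖ ^ 2 / Real.pi *
        (Real.pi * w n / ‖canonicalPlus hΓ‖ ^ 2) := by
      have := Real.pi_ne_zero
      generalize ‖canonicalPlus hΓ‖ ^ 2 = K at hK
      field_simp
    have hd0 : HasDerivAt (fun θ : ℝ => s (((n : ℤ) : ℝ) + θ))
        (Real.pi * w n / ‖canonicalPlus hΓ‖ ^ 2) 0 :=
      HasDerivAt.comp_const_add ((n : ℤ) : ℝ) 0 (by rwa [add_zero])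
    refine ⟨hd.differentiableAt, ?_, ?_⟩
    · rw [hd0.hasDerivWithinAt.derivWithin
        (uniqueDiffOn_Ico (0 : ℝ) 1 0 ⟨le_rfl, zero_lt_one⟩)]
      exact hw'
    · rw [hd.deriv]
      exact hw'
  · rw [(hs.hasDerivAt hF ht hacc hw n).deriv, h, div_one]
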